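/- Let $t=(t^{(1)},t^{(2)},t^{(3)})$ with $t^{(i)}=(t^{(i)}_1,t^{(i)}_2,\dots)$, $\xi(t^{(i)},z)=\sum_{k\ge1}t^{(i)}_kz^k$, $[z]=(z,z^2/2,z^3/3,\dots)$, and let $t\mp[z]_i$ denote $t$ with $t^{(i)}$ replaced by $t^{(i)}\mp[z]$. For $\bm m=(m_1,m_2)\in\mathbb Z^2$ put $\bm e_1=(1,0)$, $\bm e_2=(0,1)$, $\bm e=(1,1)$. Let $\tau_{\bm m}\in\mathbb C[[t]]$ ($\bm m\in\mathbb Z^2$) be nonzero formal power series that satisfy the three-component KP bilinear equation: for all $\bm m,\bm m'\in\mathbb Z^2$ and independent times $t,t'$, $$\oint_{C_R}\frac{dz}{2\pi i}z^{m_1-m_1'}e^{\xi(t^{(1)}-t'^{(1)},z)}\tau_{\bm m}(t-[z^{-1}]_1)\tau_{\bm m'}(t'+[z^{-1}]_1)$$ $$=\oint_{C_r}\frac{dz}{2\pi i}z^{m_2-m_2'}e^{\xi(t^{(2)}-t'^{(2)},z^{-1})}\tau_{\bm m+\bm e}(t-[z]_2)\tau_{\bm m'-\bm e}(t'+[z]_2)$$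 $$\quad+\oint_{C_r}\frac{dz}{2\pi i}(-1)^{m_2+m_2'}z^{m_1-m_2-m_1'+m_2'}e^{\xi(t^{(3)}-t'^{(3)},z^{-1})}\tau_{\bm m+\bm e_1}(t-[z]_3)\tau_{\bm m'-\bm e_1}(t'+[z]_3),$$ where each contour integral means the coefficient of $z^{-1}$ of the formal expansion. Let $\Lambda_1,\Lambda_2$ be the shifts $\Lambda_i(f(\bm m))=f(\bm m+\bm e_i)$, $\Delta_2=\Lambda_2-1$, $\Delta_2^*=\Lambda_2^{-1}-1$, $\Delta_2^{-1}=\sum_{j\ge1}\Lambda_2^{-j}$, $(\Delta_2^*)^{-1}=\sum_{j\ge1}\Lambda_2^{j}$. Formal operators are $A=\sum a_{j_1,j_2}(\bm m)\Lambda_1^{j_1}\Lambda_2^{j_2}$ with coefficients in the fraction field of $\mathbb C[[t]]$. $A_{i,P}$ is the sum of the terms of $A$ whose order $j_i$ in $\Lambda_i$ satisfies $P$ ($P=[0]$ means order $0$); $A_{\Delta_2,\ge1}$ (resp. $A_{\Delta_2^*,\ge1}$) is the part of positive order in $\Delta_2$ (resp. $\Delta_2^*$) after rewriting $A$ in powers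 of $\Delta_2$ (resp. $\Delta_2^*$) by $\Lambda_2^n=\sum_{s\ge0}\binom ns\Delta_2^{n-s}$ (resp. $\Lambda_2^{-n}=\sum_{s\ge0}\binom ns(\Delta_2^*)^{n-s}$), $n\in\mathbb Z$; $\iota_{\Lambda_1^{\pm1}}$ means expansion in powers of $\Lambda_1^{\pm1}$ with orders bounded below in that variable. $\partial_{t_k^{(i)}}$ acts on operators coefficientwise. Define the wave operators $S_1(\Lambda_1)=\sum_{n\ge0}a^{(1)}_n(\bm m)\Lambda_1^{-n}$, $S_2(\Lambda_2)=\sum_{n\ge0}a^{(2)}_n(\bm m)\Lambda_2^{n}$, $S_3(\Lambda_1)=\sum_{n\ge0}a^{(3)}_n(\bm m)\Lambda_1^{n}$, $S_3(\Lambda_2^{-1})=\sum_{n\ge0}a^{(3)}_n(\bm m)\Lambda_2^{-n}$, where $$\sum_n a_n^{(1)}z^{-n}=\frac{\tau_{\bm m}(t-[z^{-1}]_1)}{\tau_{\bm m}(t)},\quad \sum_n a_n^{(2)}z^{n}=\frac{\tau_{\bm m+\bm e}(t-[z]_2)}{\tau_{\bm m}(t)},\quad \sum_n a_n^{(3)}z^{n}=(-1)^{m_2}\frac{\tau_{\bm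 m+\bm e_1}(t-[z]_3)}{\tau_{\bm m}(t)},$$ the Lax operators $L_1=S_1\Lambda_1S_1^{-1}$, $L_2=S_2\Lambda_2^{-1}S_2^{-1}$, $L_3(\Lambda_1)=S_3(\Lambda_1)\Lambda_1^{-1}S_3(\Lambda_1)^{-1}$, $L_3(\Lambda_2^{-1})=S_3(\Lambda_2^{-1})\Lambda_2S_3(\Lambda_2^{-1})^{-1}$, and $$B_k^{(1)}=(L_1^k)_{1,\ge0},\quad B_k^{(2)}=(L_2^k)_{\Delta_2^*,\ge1},\quad B_k^{(3)}(\Lambda_1)=(L_3(\Lambda_1)^k)_{1,<0},\quad B_k^{(3)}(\Lambda_2^{-1})=(L_3(\Lambda_2^{-1})^k)_{\Delta_2,\ge1}.$$ Let $\rho=\dfrac{\tau_{\bm m}}{\tau_{\bm m+\bm e_1}}\dfrac{\tau_{\bm m+\bm e+\bm e_1}}{\tau_{\bm m+\bm e}}$ and $H=\Lambda_1\Delta_2+\rho$. Then for every $k\ge1$, $$\partial_{t_k^{(1)}}H=C^{(1)}H-H B_k^{(1)},\qquad \partial_{t_k^{(2)}}H=C^{(2)}H-H B_k^{(2)},$$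 $$\partial_{t_k^{(3)}}H=C^{(3)}(\Lambda_1)H-H B_k^{(3)}(\Lambda_1)=C^{(3)}(\Lambda_2)H-H B_k^{(3)}(\Lambda_2^{-1}),$$ where $$C^{(1)}=\big((\Lambda_1-\rho)L_1^k\,\iota_{\Lambda_1^{-1}}(\Lambda_1-\rho)^{-1}\big)_{1,\ge0},$$ $$C^{(2)}=\big(\rho L_2^k\rho^{-1}\big)_{2,\le0}-\big((\Delta_2^*)^{-1}\Lambda_2^{-1}\rho L_2^k\rho^{-1}\big)_{2,[0]},$$ $$C^{(3)}(\Lambda_1)=\big((\Lambda_1-\rho)L_3(\Lambda_1)^k\,\iota_{\Lambda_1}(\Lambda_1-\rho)^{-1}\big)_{1,<0},$$ $$C^{(3)}(\Lambda_2)=\big(\rho L_3(\Lambda_2^{-1})^k\rho^{-1}\big)_{2,\ge0}-\big(\Delta_2^{-1}\Lambda_2\,\rho L_3(\Lambda_2^{-1})^k\rho^{-1}\big)_{2,[0]}.$$ -/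

import Mathlib

namespace ThreeKP

noncomputable section

/-! ### Time variables, formal functions of the times, time derivatives -/

/-- Index set of the times: `(i, k)` stands for `t_k^{(i+1)}`, with `i = 0, 1, 2` and `k ≥ 1`. -/
abbrev Time := Fin 3 × ℕ+

/-- Formal power series in all the times `t = (t^{(1)}, t^{(2)}, t^{(3)})`. -/
abbrev TimeSeries := MvPowerSeries Time ℂ

/-- Quotients of formal power series in the times. -/
abbrev TimeField := FractionRing TimeSeries

/-- The partial derivative `∂/∂t_k^{(i)}` on quotients of power series, by the quotient rule. -/
def timeDeriv (p : Time) (x : TimeField) : TimeField :=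
  let a : TimeSeries := (IsLocalization.sec (nonZeroDivisors TimeSeries) x).1
  let b : TimeSeries := (IsLocalization.sec (nonZeroDivisors TimeSeries) x).2
  algebraMap TimeSeries TimeField (MvPowerSeries.pderiv ℂ p a * b - a * MvPowerSeries.pderiv ℂ p b) /
    algebraMap TimeSeries TimeField b ^ 2

/-- The value of `timeDeriv` does not depend on how an element is written as a quotient. -/
theorem timeDeriv_div (p : Time) (a b : TimeSeries) (hb : b ≠ 0) :
    timeDeriv p (algebraMap TimeSeries TimeField a / algebraMap TimeSeries TimeField b) =
      algebraMap TimeSeries TimeField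
        (MvPowerSeries.pderiv ℂ p a * b - a * MvPowerSeries.pderiv ℂ p b) /
        algebraMap TimeSeries TimeField b ^ 2 := by
  set x : TimeField := algebraMap TimeSeries TimeField a / algebraMap TimeSeries TimeField b with hx
  have hinj : Function.Injective (algebraMap TimeSeries TimeField) :=
    IsFractionRing.injective TimeSeries TimeField
  have hs := IsLocalization.sec_spec (nonZeroDivisors TimeSeries) x
  unfold timeDeriv
  simp only
  generalize (IsLocalization.sec (nonZeroDivisors TimeSeries) x).1 = c at hs ⊢
  generalize (IsLocalization.sec (nonZeroDivisors TimeSeries) x).2 = d at hs ⊢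
  obtain ⟨d, hd⟩ := d
  simp only at hs ⊢
  have hd0 : d ≠ 0 := nonZeroDivisors.ne_zero hd
  have hB : algebraMap TimeSeries TimeField b ≠ 0 := by
    simpa using hinj.ne hb
  have hD : algebraMap TimeSeries TimeField d ≠ 0 := by
    simpa using hinj.ne hd0
  have hcross : a * d = c * b := by
    apply hinj
    rw [map_mul, map_mul, ← hs, hx]
    field_simp
  have hder := congrArg (MvPowerSeries.pderiv ℂ p) hcross
  simp only [Derivation.leibniz, smul_eq_mul] at hder
  rw [div_eq_div_iff (pow_ne_zero 2 hD) (pow_ne_zero 2 hB), ← map_pow, ← map_pow, ← map_mul,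
    ← map_mul]
  congr 1
  generalize MvPowerSeries.pderiv ℂ p a = a' at *
  generalize MvPowerSeries.pderiv ℂ p b = b' at *
  generalize MvPowerSeries.pderiv ℂ p c = c' at *
  generalize MvPowerSeries.pderiv ℂ p d = d' at *
  linear_combination (-(b * d)) * hder + (b * d' + b' * d) * hcross

/-! ### The bilinear equation -/

/-- The substitution `t ↦ t + c [z]_i`, that is `t_k^{(i)} ↦ t_k^{(i)} + c z^k / k`, the times of
the other components being fixed; the extra variable `none` is `z`. -/
def shiftVar (i : Fin 3) (c : ℂ) (p : Time) : MvPowerSeries (Option Time) ℂ :=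
  MvPowerSeries.X (some p) +
    if p.1 = i then
      MvPowerSeries.C (c / (p.2 : ℕ) : ℂ) * MvPowerSeries.X none ^ (p.2 : ℕ)
    else 0

/-- The coefficient of `z ^ n` in `f (t + c [z]_i)`. -/
def shiftCoeff (i : Fin 3) (c : ℂ) (f : TimeSeries) (n : ℕ) : TimeSeries :=
  fun d => MvPowerSeries.coeff (d.mapDomain some + Finsupp.single none n)
    (MvPowerSeries.subst (shiftVar i c) f)

/-- Formal power series in the two independent sets of times `t` (`Sum.inl`) and `t'`
(`Sum.inr`). -/
abbrev TwoTimeSeries := MvPowerSeries (Time ⊕ Time) ℂ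

instance : Filter.TendstoCofinite (Sum.inl : Time → Time ⊕ Time) :=
  ⟨Sum.inl_injective.tendsto_cofinite⟩

instance : Filter.TendstoCofinite (Sum.inr : Time → Time ⊕ Time) :=
  ⟨Sum.inr_injective.tendsto_cofinite⟩

/-- `ξ(t^{(i)} - t'^{(i)}, z) = ∑_{k ≥ 1} (t_k^{(i)} - t'_k^{(i)}) z ^ k`, as a series in `z`. -/
def xiDiff (i : Fin 3) : PowerSeries TwoTimeSeries :=
  PowerSeries.mk fun k =>
    if h : 0 < k then
      MvPowerSeries.X (Sum.inl (i, ⟨k, h⟩)) - MvPowerSeries.X (Sum.inr (i, ⟨k, h⟩))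
    else 0

/-- The coefficient of `z ^ n` in `exp (ξ(t^{(i)} - t'^{(i)}, z))`. As `ξ` has no constant term
in `z`, only its powers `ξ ^ r / r!` with `r ≤ n` contribute. -/
def expXi (i : Fin 3) (n : ℕ) : TwoTimeSeries :=
  ∑ r ∈ Finset.range (n + 1),
    ((Nat.factorial r : ℂ)⁻¹) • PowerSeries.coeff n (xiDiff i ^ r)

/-- The coefficient of `z ^ l` in `f (t - [z]_i) * g (t' + [z]_i)`, for an integer `l`. -/
def pairCoeff (i : Fin 3) (f g : TimeSeries) (l : ℤ) : TwoTimeSeries :=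
  if 0 ≤ l then
    ∑ q ∈ Finset.HasAntidiagonal.antidiagonal l.toNat,
      MvPowerSeries.rename Sum.inl (shiftCoeff i (-1) f q.1) *
        MvPowerSeries.rename Sum.inr (shiftCoeff i 1 g q.2)
  else 0

/-- `∮_{C_R} dz/(2πi) z ^ a e^{ξ(t^{(i)} - t'^{(i)}, z)} f (t - [z⁻¹]_i) g (t' + [z⁻¹]_i)`, that is
the coefficient of `z⁻¹`. For each monomial in `t, t'` only finitely many `n` contribute. -/
def resInfty (i : Fin 3) (a : ℤ) (f g : TimeSeries) : TwoTimeSeries :=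
  fun d => ∑ᶠ n : ℕ, MvPowerSeries.coeff d (expXi i n * pairCoeff i f g (n + a + 1))

/-- `∮_{C_r} dz/(2πi) z ^ a e^{ξ(t^{(i)} - t'^{(i)}, z⁻¹)} f (t - [z]_i) g (t' + [z]_i)`, that is
the coefficient of `z⁻¹`. For each monomial in `t, t'` only finitely many `n` contribute. -/
def resZero (i : Fin 3) (a : ℤ) (f g : TimeSeries) : TwoTimeSeries :=
  fun d => ∑ᶠ n : ℕ, MvPowerSeries.coeff d (expXi i n * pairCoeff i f g (n - a - 1))

/-- The lattice of the discrete variables `m = (m₁, m₂)`. -/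
abbrev Site := ℤ × ℤ

/-- The bilinear equation of the three-component KP hierarchy for the tau functions `τ_m(t)`. -/
def IsThreeKPTau (τ : Site → TimeSeries) : Prop :=
  ∀ m m' : Site,
    resInfty 0 (m.1 - m'.1) (τ m) (τ m') =
      resZero 1 (m.2 - m'.2) (τ (m + (1, 1))) (τ (m' - (1, 1))) +
      ((-1 : ℂ) ^ (m.2 + m'.2)) •
        resZero 2 (m.1 - m.2 - m'.1 + m'.2) (τ (m + (1, 0))) (τ (m' - (1, 0)))

/-! ### Formal operators in the shifts `Λ₁, Λ₂` -/

/-- A formal operator `∑ a_j(m) Λ₁ ^ j₁ Λ₂ ^ j₂`, given by its coefficients: `A j m = a_j(m)`. -/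
def Op : Type := Site → Site → TimeField

namespace Op

instance : AddCommGroup Op := inferInstanceAs (AddCommGroup (Site → Site → TimeField))

/-- The operator of multiplication by a function of `m` (and `t`). -/
def fn (f : Site → TimeField) : Op := fun j m => if j = 0 then f m else 0

/-- `Λ₁ ^ v₁ Λ₂ ^ v₂`. -/
def shift (v : Site) : Op := fun j _ => if j = v then 1 else 0

instance : One Op := ⟨fn 1⟩

/-- The product of operators, determined by `Λ ^ p · b(m) = b(m + p) Λ ^ p`; it is used only for
operators for which every coefficient of the product is a finite sum. -/
instance : Mul Op := ⟨fun A B j m => ∑ᶠ p : Site, A p m * B (j - p) (m + p)⟩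

instance : Pow Op ℕ := ⟨fun A k => npowRec k A⟩

/-- The coefficientwise derivative with respect to a time. -/
def tderiv (p : Time) (A : Op) : Op := fun j m => timeDeriv p (A j m)

/-- `A_{1,P}`: the terms whose `Λ₁`-order satisfies `P`. -/
def part₁ (P : ℤ → Prop) [DecidablePred P] (A : Op) : Op :=
  fun j m => if P j.1 then A j m else 0

/-- `A_{2,P}`: the terms whose `Λ₂`-order satisfies `P`. -/
def part₂ (P : ℤ → Prop) [DecidablePred P] (A : Op) : Op :=
  fun j m => if P j.2 then A j m else 0

/-- The one-variable series `∑_{n ≥ 0} c_n(m) Q ^ n` in the shift `Q = Λ ^ v`. -/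
def series (v : Site) (c : ℕ → Site → TimeField) : Op :=
  fun j m => ∑ᶠ n : ℕ, if j = n • v then c n m else 0

/-- The coefficients `b_n` of the inverse of `∑_{n ≥ 0} c_n Q ^ n`, `Q = Λ ^ v`, for `c_0` without
zeros, from `b_0 c_0 = 1` and `∑_{p ≤ n} b_p(m) c_{n-p}(m + p v) = 0` for `n ≥ 1`. -/
def invCoeff (v : Site) (c : ℕ → Site → TimeField) (n : ℕ) (m : Site) : TimeField :=
  ((if n = 0 then 1 else 0) -
    ∑ p : Fin n, invCoeff v c p.1 m * c (n - p.1) (m + p.1 • v)) / c 0 (m + n • v)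
termination_by n
decreasing_by exact p.2

/-- The inverse, as a series in increasing powers of `Q = Λ ^ v`, of an operator
`A = ∑_{n ≥ 0} a_n(m) Q ^ (N + n)` whose leading coefficient `a_0` has no zeros: writing
`A = A' Q ^ N`, this is `Q ^ (-N) A'⁻¹`. -/
def inv (v : Site) (N : ℤ) (A : Op) : Op :=
  shift (-(N • v)) * series v (invCoeff v fun n => A ((N + n) • v))

def Λ₁ : Op := shift (1, 0)
def Λ₂ : Op := shift (0, 1)
def Λ₁inv : Op := shift (-1, 0)
def Λ₂inv : Op := shift (0, -1)

/-- `Δ₂ = Λ₂ - 1`. -/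
def Δ₂ : Op := Λ₂ - 1

/-- `Δ₂^* = Λ₂⁻¹ - 1`. -/
def Δ₂star : Op := Λ₂inv - 1

/-- `Δ₂⁻¹ = ∑_{j ≥ 1} Λ₂ ^ (-j)`. -/
def Δ₂Inv : Op := series (0, -1) fun n _ => if 1 ≤ n then 1 else 0

/-- `(Δ₂^*)⁻¹ = ∑_{j ≥ 1} Λ₂ ^ j`. -/
def Δ₂starInv : Op := series (0, 1) fun n _ => if 1 ≤ n then 1 else 0

/-- The coefficient (an operator without `Λ₂`) of `Δ₂ ^ q` when `A` is rewritten in powers of `Δ₂`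
by means of `Λ₂ ^ n = (Δ₂ + 1) ^ n = ∑_{s ≥ 0} (n choose s) Δ₂ ^ (n - s)`, `n ∈ ℤ`; for `A` whose
`Λ₂`-orders are bounded above. -/
def Δ₂coeff (A : Op) (q : ℤ) : Op :=
  fun j m => if j.2 = 0 then ∑ᶠ s : ℕ, Ring.choose (q + s) s • A (j.1, q + s) m else 0

/-- The coefficient (an operator without `Λ₂`) of `(Δ₂^*) ^ q` when `A` is rewritten in powers of
`Δ₂^*` by means of `Λ₂ ^ (-n) = (Δ₂^* + 1) ^ n = ∑_{s ≥ 0} (n choose s) (Δ₂^*) ^ (n - s)`,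
`n ∈ ℤ`; for `A` whose `Λ₂`-orders are bounded below. -/
def Δ₂starCoeff (A : Op) (q : ℤ) : Op :=
  fun j m => if j.2 = 0 then ∑ᶠ s : ℕ, Ring.choose (q + s) s • A (j.1, -(q + s)) m else 0

/-- `A_{Δ₂, ≥ 1}`: the part of `A` of positive order with respect to `Δ₂`. -/
def Δ₂part (A : Op) : Op := ∑ᶠ q : ℕ, if 1 ≤ q then Δ₂coeff A q * Δ₂ ^ q else 0

/-- `A_{Δ₂^*, ≥ 1}`: the part of `A` of positive order with respect to `Δ₂^*`. -/
def Δ₂starPart (A : Op) : Op :=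
  ∑ᶠ q : ℕ, if 1 ≤ q then Δ₂starCoeff A q * Δ₂star ^ q else 0

end Op

open Op

/-! ### Wave operators, Lax operators and the operator `H` -/

/-- A tau function as an element of the field of quotients. -/
def tauQ (f : TimeSeries) : TimeField := algebraMap TimeSeries TimeField f

/-- `S₁ = ∑ a_n(m) Λ₁ ^ (-n)` with `∑ a_n(m) z ^ (-n) = τ_m(t - [z⁻¹]_1) / τ_m(t)`. -/
def S₁ (τ : Site → TimeSeries) : Op :=
  series (-1, 0) fun n m => tauQ (shiftCoeff 0 (-1) (τ m) n) / tauQ (τ m)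

/-- `S₂ = ∑ a_n(m) Λ₂ ^ n` with `∑ a_n(m) z ^ n = τ_{m+e}(t - [z]_2) / τ_m(t)`, `e = (1, 1)`. -/
def S₂ (τ : Site → TimeSeries) : Op :=
  series (0, 1) fun n m => tauQ (shiftCoeff 1 (-1) (τ (m + (1, 1))) n) / tauQ (τ m)

/-- The coefficients of `z ^ n` in `(-1) ^ m₂ τ_{m+e₁}(t - [z]_3) / τ_m(t)`. -/
def waveCoeff₃ (τ : Site → TimeSeries) (n : ℕ) (m : Site) : TimeField :=
  (-1) ^ m.2 * tauQ (shiftCoeff 2 (-1) (τ (m + (1, 0))) n) / tauQ (τ m)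

/-- `S₃(m, Λ₁)`. -/
def S₃ (τ : Site → TimeSeries) : Op := series (1, 0) (waveCoeff₃ τ)

/-- `S₃(m, Λ₂⁻¹)`: the same coefficients, with `Λ₁` replaced by `Λ₂⁻¹`. -/
def S₃' (τ : Site → TimeSeries) : Op := series (0, -1) (waveCoeff₃ τ)

/-- `L₁(Λ₁) = S₁ Λ₁ S₁⁻¹`. -/
def L₁ (τ : Site → TimeSeries) : Op := S₁ τ * Λ₁ * inv (-1, 0) 0 (S₁ τ)

/-- `L₂(Λ₂) = S₂ Λ₂⁻¹ S₂⁻¹`. -/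
def L₂ (τ : Site → TimeSeries) : Op := S₂ τ * Λ₂inv * inv (0, 1) 0 (S₂ τ)

/-- `L₃(Λ₁) = S₃(Λ₁) Λ₁⁻¹ S₃(Λ₁)⁻¹`. -/
def L₃ (τ : Site → TimeSeries) : Op := S₃ τ * Λ₁inv * inv (1, 0) 0 (S₃ τ)

/-- `L₃(Λ₂⁻¹) = S₃(Λ₂⁻¹) Λ₂ S₃(Λ₂⁻¹)⁻¹`. -/
def L₃' (τ : Site → TimeSeries) : Op := S₃' τ * Λ₂ * inv (0, -1) 0 (S₃' τ)

/-- `B_k^{(1)} = (L₁ ^ k)_{1, ≥ 0}`. -/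
def B₁ (τ : Site → TimeSeries) (k : ℕ) : Op := part₁ (fun j => 0 ≤ j) (L₁ τ ^ k)

/-- `B_k^{(2)} = (L₂ ^ k)_{Δ₂^*, ≥ 1}`. -/
def B₂ (τ : Site → TimeSeries) (k : ℕ) : Op := Δ₂starPart (L₂ τ ^ k)

/-- `B_k^{(3)}(Λ₁) = (L₃(Λ₁) ^ k)_{1, < 0}`. -/
def B₃ (τ : Site → TimeSeries) (k : ℕ) : Op := part₁ (fun j => j < 0) (L₃ τ ^ k)

/-- `B_k^{(3)}(Λ₂⁻¹) = (L₃(Λ₂⁻¹) ^ k)_{Δ₂, ≥ 1}`. -/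
def B₃' (τ : Site → TimeSeries) (k : ℕ) : Op := Δ₂part (L₃' τ ^ k)

/-- `ρ = τ_m τ_{m+e+e₁} / (τ_{m+e₁} τ_{m+e})`, with `e₁ = (1, 0)` and `e = (1, 1)`. -/
def rho (τ : Site → TimeSeries) (m : Site) : TimeField :=
  tauQ (τ m) / tauQ (τ (m + (1, 0))) *
    (tauQ (τ (m + (1, 1) + (1, 0))) / tauQ (τ (m + (1, 1))))

/-- `H = Λ₁ Δ₂ + ρ`. -/
def H (τ : Site → TimeSeries) : Op := Λ₁ * Δ₂ + fn (rho τ)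

/-- `Λ₁ - ρ`. -/
def Λ₁subRho (τ : Site → TimeSeries) : Op := Λ₁ - fn (rho τ)

/-- `C^{(1)} = ((Λ₁ - ρ) L₁ ^ k (Λ₁ - ρ)⁻¹)_{1, ≥ 0}`, with `(Λ₁ - ρ)⁻¹` expanded in powers of
`Λ₁⁻¹`. -/
def C₁ (τ : Site → TimeSeries) (k : ℕ) : Op :=
  part₁ (fun j => 0 ≤ j) (Λ₁subRho τ * L₁ τ ^ k * inv (-1, 0) (-1) (Λ₁subRho τ))

/-- `C^{(2)} = (ρ L₂ ^ k ρ⁻¹)_{2, ≤ 0} - ((Δ₂^*)⁻¹ Λ₂⁻¹ ρ L₂ ^ k ρ⁻¹)_{2, [0]}`. -/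
def C₂ (τ : Site → TimeSeries) (k : ℕ) : Op :=
  part₂ (fun j => j ≤ 0) (fn (rho τ) * L₂ τ ^ k * fn (rho τ)⁻¹) -
    part₂ (fun j => j = 0)
      (Δ₂starInv * Λ₂inv * fn (rho τ) * L₂ τ ^ k * fn (rho τ)⁻¹)

/-- `C^{(3)}(Λ₁) = ((Λ₁ - ρ) L₃(Λ₁) ^ k (Λ₁ - ρ)⁻¹)_{1, < 0}`, with `(Λ₁ - ρ)⁻¹` expanded in powers
of `Λ₁`. -/
def C₃ (τ : Site → TimeSeries) (k : ℕ) : Op :=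
  part₁ (fun j => j < 0) (Λ₁subRho τ * L₃ τ ^ k * inv (1, 0) 0 (Λ₁subRho τ))

/-- `C^{(3)}(Λ₂) = (ρ L₃(Λ₂⁻¹) ^ k ρ⁻¹)_{2, ≥ 0} - (Δ₂⁻¹ Λ₂ ρ L₃(Λ₂⁻¹) ^ k ρ⁻¹)_{2, [0]}`. -/
def C₃' (τ : Site → TimeSeries) (k : ℕ) : Op :=
  part₂ (fun j => 0 ≤ j) (fn (rho τ) * L₃' τ ^ k * fn (rho τ)⁻¹) -
    part₂ (fun j => j = 0)
      (Δ₂Inv * Λ₂ * fn (rho τ) * L₃' τ ^ k * fn (rho τ)⁻¹)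

end

end ThreeKP

set_option linter.unusedSectionVars false
set_option linter.unnecessarySeqFocus false

namespace ThreeKP

noncomputable section

/-! ### Time derivative as a derivation of the field of quotients -/

/-! At equal times the bilinear equation becomes linear. Attach to each site `m` the triple `wave τ
m` of formal wave functions, in which the `i`-th series starts at order `waveOrd i m`. Putting `t' =
t` removes the exponentials, and the equation says that this triple is orthogonal, in a residue
pairing, to all dual wave functions. Differentiating in `t_k^{(i)}` before putting `t' = t` gives
the same statement for `waveDeriv`. There the exponential contributes one extra term, the `i`-th
series shifted by `k`. The orthogonal triples form a vector space `bilinear` over the field of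
functions of `t`.

The engine is the uniqueness statement `eq_zero_of_mem_bilinear`: a triple in this space whose three
series start late enough is zero, because the pairing is triangular with the nonzero tau functions
on the diagonal. An identity between wave functions therefore needs to be checked only on finitely
many leading coefficients. For `Λ₁Δ₂ + ρ` the leading terms cancel by the choice of `ρ`, which gives
`H Ψ = 0` (`wave_linear`). For the evolution in `t_k^{(i)}` the leading terms force the projection
that defines `B`, which gives the Sato equation `∂S = B S - S Q ^ (-k)` (`deriv_wave_operator`). For
the two operators `B` in powers of `Λ₂`, the first series is normalised to leading coefficient `1`,
so `B` must annihilate constants. This is why the positive part in `Δ₂^*` or `Δ₂` appears.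

The rest is algebra in the ring `OpRing v` of operators expanded in `Q = Λ ^ v`, with `v` one of the
four unit steps. Read on the `i`-th component, `H Ψ = 0` becomes `F S Y = T S`, where `H = ±(T -
F)`, `F` is a constant operator `K Λ ^ u` with `K = 1` or `K = 1 - Q`, and `Y` is a shift.
Differentiating and inserting the Sato equation gives `∂T = C T - T B` for any `C` with `C F = F B`
(`deriv_eq_of_dressing`). As `∂F = 0 = C F - F B`, the operator `H` obeys the same law.

It remains to recognise `C = F B F⁻¹` as the operator in the statement. Since `S Y S⁻¹` commutes
with the Lax operator, conjugating a power of it by `T` or by `F` gives the same result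
(`conj_lax_eq`). For `K = 1` the projection commutes with conjugation by a shift. For `K = 1 - Q`
the correction term of order zero comes from `part_nonpos_sub`. -/

theorem exists_eq_algebraMap_div (x : TimeField) :
    ∃ a b : TimeSeries, b ≠ 0 ∧
      x = algebraMap TimeSeries TimeField a / algebraMap TimeSeries TimeField b := by
  obtain ⟨a, b, hb, rfl⟩ := IsFractionRing.div_surjective (A := TimeSeries) x
  exact ⟨a, b, nonZeroDivisors.ne_zero hb, rfl⟩

theorem tauQ_ne_zero {f : TimeSeries} (hf : f ≠ 0) : tauQ f ≠ 0 := by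
  simpa [tauQ] using (IsFractionRing.injective TimeSeries TimeField).ne hf

/-- Independence of the representative, `timeDeriv_div`, allows the quotient rule to be applied over
a common denominator. -/
theorem timeDeriv_add (p : Time) (x y : TimeField) :
    timeDeriv p (x + y) = timeDeriv p x + timeDeriv p y := by
  obtain ⟨a, b, hb, rfl⟩ := exists_eq_algebraMap_div x
  obtain ⟨c, d, hd, rfl⟩ := exists_eq_algebraMap_div y
  have hB := tauQ_ne_zero hb
  have hD := tauQ_ne_zero hd
  unfold tauQ at hB hD
  have h : algebraMap TimeSeries TimeField a / algebraMap TimeSeries TimeField b +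
      algebraMap TimeSeries TimeField c / algebraMap TimeSeries TimeField d =
      algebraMap TimeSeries TimeField (a * d + c * b) / algebraMap TimeSeries TimeField (b * d) := by
    simp only [map_mul, map_add]
    field_simp
  rw [h, timeDeriv_div _ _ _ (mul_ne_zero hb hd), timeDeriv_div _ _ _ hb, timeDeriv_div _ _ _ hd]
  simp only [map_sub, map_mul, map_add, Derivation.leibniz, smul_eq_mul]
  field_simp
  ring

theorem timeDeriv_mul (p : Time) (x y : TimeField) :
    timeDeriv p (x * y) = timeDeriv p x * y + x * timeDeriv p y := by
  obtain ⟨a, b, hb, rfl⟩ := exists_eq_algebraMap_div x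
  obtain ⟨c, d, hd, rfl⟩ := exists_eq_algebraMap_div y
  have hB := tauQ_ne_zero hb
  have hD := tauQ_ne_zero hd
  unfold tauQ at hB hD
  have h : algebraMap TimeSeries TimeField a / algebraMap TimeSeries TimeField b *
      (algebraMap TimeSeries TimeField c / algebraMap TimeSeries TimeField d) =
      algebraMap TimeSeries TimeField (a * c) / algebraMap TimeSeries TimeField (b * d) := by
    simp only [map_mul]
    field_simp
  rw [h, timeDeriv_div _ _ _ (mul_ne_zero hb hd), timeDeriv_div _ _ _ hb, timeDeriv_div _ _ _ hd]
  simp only [map_sub, map_mul, map_add, Derivation.leibniz, smul_eq_mul]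
  field_simp
  ring

theorem timeDeriv_one (p : Time) : timeDeriv p 1 = 0 := by
  have := timeDeriv_mul p 1 1
  simpa using this

/-- `timeDeriv` as an additive map. -/
def timeDerivHom (p : Time) : TimeField →+ TimeField :=
  AddMonoidHom.mk' (timeDeriv p) (timeDeriv_add p)

theorem timeDeriv_zero (p : Time) : timeDeriv p 0 = 0 := (timeDerivHom p).map_zero

theorem timeDeriv_neg (p : Time) (x : TimeField) : timeDeriv p (-x) = -timeDeriv p x :=
  (timeDerivHom p).map_neg x

/-! ### Operators of bounded below order along a unit step -/

/-- A step of length one along one of the two axes of the lattice. -/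
class IsUnitStep (v : Site) : Prop where
  norm_eq_one : v.1 * v.1 + v.2 * v.2 = 1

instance : IsUnitStep (1, 0) := ⟨rfl⟩
instance : IsUnitStep (-1, 0) := ⟨rfl⟩
instance : IsUnitStep (0, 1) := ⟨rfl⟩
instance : IsUnitStep (0, -1) := ⟨rfl⟩

/-- The component of `j` along `v`. -/
def along (v j : Site) : ℤ := v.1 * j.1 + v.2 * j.2

/-- The component of `j` across `v`. -/
def across (v j : Site) : ℤ := v.2 * j.1 - v.1 * j.2

theorem along_add (v i j : Site) : along v (i + j) = along v i + along v j := by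
  simp [along]; ring

theorem across_add (v i j : Site) : across v (i + j) = across v i + across v j := by
  simp [across]; ring

theorem along_sub (v i j : Site) : along v (i - j) = along v i - along v j := by
  simp [along]; ring

theorem across_sub (v i j : Site) : across v (i - j) = across v i - across v j := by
  simp [across]; ring

@[simp] theorem along_zero (v : Site) : along v 0 = 0 := by simp [along]

@[simp] theorem across_zero (v : Site) : across v 0 = 0 := by simp [across]

theorem along_zsmul (v : Site) [h : IsUnitStep v] (n : ℤ) : along v (n • v) = n := by
  have := h.norm_eq_one
  simp only [along, Prod.smul_fst, Prod.smul_snd, smul_eq_mul]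
  linear_combination n * this

theorem across_zsmul (v : Site) (n : ℤ) : across v (n • v) = 0 := by
  simp only [across, Prod.smul_fst, Prod.smul_snd, smul_eq_mul]
  ring

theorem eq_of_along_across (v : Site) [h : IsUnitStep v] {i j : Site} (h₁ : along v i = along v j)
    (h₂ : across v i = across v j) : i = j := by
  have := h.norm_eq_one
  unfold along across at *
  ext
  · linear_combination v.1 * h₁ + v.2 * h₂ + (j.1 - i.1) * this
  · linear_combination v.2 * h₁ - v.1 * h₂ + (j.2 - i.2) * this

theorem eq_zsmul_of_across_eq_zero (v : Site) [IsUnitStep v] {j : Site} (h : across v j = 0) :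
    j = along v j • v :=
  eq_of_along_across v (along_zsmul v _).symm (by rw [h, across_zsmul])

theorem finite_along_across (v : Site) [IsUnitStep v] (a b c d : ℤ) :
    {p : Site | a ≤ along v p ∧ along v p ≤ b ∧ c ≤ across v p ∧ across v p ≤ d}.Finite := by
  refine Set.Finite.of_finite_image (f := fun p => (along v p, across v p))
    (((Set.finite_Icc a b).prod (Set.finite_Icc c d)).subset ?_) ?_
  · rintro _ ⟨p, ⟨h1, h2, h3, h4⟩, rfl⟩
    exact ⟨⟨h1, h2⟩, h3, h4⟩
  · intro p _ q _ hpq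
    simp only [Prod.mk.injEq] at hpq
    exact eq_of_along_across v hpq.1 hpq.2

namespace Op

@[ext] theorem ext {A B : Op} (h : ∀ j m, A j m = B j m) : A = B := funext fun j => funext (h j)

theorem add_apply (A B : Op) (j m : Site) : (A + B) j m = A j m + B j m := rfl
theorem sub_apply (A B : Op) (j m : Site) : (A - B) j m = A j m - B j m := rfl
theorem neg_apply (A : Op) (j m : Site) : (-A) j m = -A j m := rfl
theorem one_apply (j m : Site) : (1 : Op) j m = if j = 0 then 1 else 0 := rfl
theorem mul_apply (A B : Op) (j m : Site) :
    (A * B) j m = ∑ᶠ p : Site, A p m * B (j - p) (m + p) := rfl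

/-- Evaluation of the coefficient at `j` and `m` as an additive map. -/
def coeffHom (j m : Site) : Op →+ TimeField :=
  AddMonoidHom.mk' (fun A => A j m) fun _ _ => rfl

/-- The order along `v` is bounded below by `a`, and the order across `v` by `b` in absolute
value. -/
def Within (v : Site) (a b : ℤ) (A : Op) : Prop :=
  ∀ j m, A j m ≠ 0 → a ≤ along v j ∧ -b ≤ across v j ∧ across v j ≤ b

/-- Operators with order bounded below along `v` and bounded across `v`. -/
def Bounded (v : Site) (A : Op) : Prop := ∃ a b, Within v a b A

theorem Within.mono {v : Site} {a b a' b' : ℤ} {A : Op} (h : Within v a b A) (ha : a' ≤ a)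
    (hb : b ≤ b') : Within v a' b' A := fun j m hA => by
  have := h j m hA
  omega

theorem Within.add {v : Site} {a b : ℤ} {A B : Op} (hA : Within v a b A)
    (hB : Within v a b B) : Within v a b (A + B) := fun j m h => by
  by_cases h0 : A j m = 0
  · exact hB j m fun h1 => h (by rw [add_apply, h0, h1, add_zero])
  · exact hA j m h0

theorem Within.neg {v : Site} {a b : ℤ} {A : Op} (hA : Within v a b A) :
    Within v a b (-A) := fun j m h => hA j m fun h1 => h (by rw [neg_apply, h1, neg_zero])

theorem Within.mul {v : Site} {a b a' b' : ℤ} {A B : Op} (hA : Within v a b A)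
    (hB : Within v a' b' B) : Within v (a + a') (b + b') (A * B) := fun j m h => by
  rw [mul_apply] at h
  obtain ⟨p, hp⟩ : ∃ p, A p m * B (j - p) (m + p) ≠ 0 := by
    by_contra! h0
    exact h ((finsum_congr h0).trans finsum_zero)
  have h1 := hA p m (left_ne_zero_of_mul hp)
  have h2 := hB _ _ (right_ne_zero_of_mul hp)
  rw [along_sub, across_sub] at h2
  omega

theorem within_fn (v : Site) (f : Site → TimeField) : Within v 0 0 (fn f) := fun j m h => by
  have : j = 0 := by
    by_contra hj
    exact h (by simp [fn, hj])
  simp [this]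

theorem Bounded.add {v : Site} {A B : Op} (hA : Bounded v A) (hB : Bounded v B) :
    Bounded v (A + B) := by
  obtain ⟨a, b, hA⟩ := hA
  obtain ⟨a', b', hB⟩ := hB
  exact ⟨min a a', max b b', (hA.mono (min_le_left _ _) (le_max_left _ _)).add
    (hB.mono (min_le_right _ _) (le_max_right _ _))⟩

theorem Bounded.neg {v : Site} {A : Op} (hA : Bounded v A) : Bounded v (-A) := by
  obtain ⟨a, b, hA⟩ := hA
  exact ⟨a, b, hA.neg⟩

theorem Bounded.mul {v : Site} {A B : Op} (hA : Bounded v A) (hB : Bounded v B) :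
    Bounded v (A * B) := by
  obtain ⟨a, b, hA⟩ := hA
  obtain ⟨a', b', hB⟩ := hB
  exact ⟨_, _, hA.mul hB⟩

theorem bounded_fn (v : Site) (f : Site → TimeField) : Bounded v (fn f) := ⟨0, 0, within_fn v f⟩

theorem bounded_zero (v : Site) : Bounded v 0 := ⟨0, 0, fun _ _ h => (h rfl).elim⟩

theorem bounded_shift (v u : Site) : Bounded v (shift u) :=
  ⟨along v u, |across v u|, fun j m h => by
    have : j = u := by
      by_contra hj
      exact h (by simp [shift, hj])
    rw [this]
    exact ⟨le_rfl, neg_abs_le _, le_abs_self _⟩⟩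

/-- The lower bounds for both factors confine the order of the first factor along `v` to an
interval, and the order across `v` is bounded anyway. The sum defining the product is thus finite,
uniformly in the base points, and `finsum` never takes its default value. -/
theorem Bounded.finite_mul {v : Site} [IsUnitStep v] {A B : Op} (hA : Bounded v A)
    (hB : Bounded v B) (j : Site) : {p | ∃ m m', A p m ≠ 0 ∧ B (j - p) m' ≠ 0}.Finite := by
  obtain ⟨a, b, hA⟩ := hA
  obtain ⟨a', b', hB⟩ := hB
  refine (finite_along_across v a (along v j - a') (-b) b).subset ?_
  rintro p ⟨m, m', h1, h2⟩
  have h1 := hA p m h1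
  have h2 := hB _ _ h2
  rw [along_sub, across_sub] at h2
  simp only [Set.mem_ofPred_eq]
  omega

theorem Bounded.finite_support_mul {v : Site} [IsUnitStep v] {A B : Op} (hA : Bounded v A)
    (hB : Bounded v B) (j m : Site) :
    (Function.support fun p : Site => A p m * B (j - p) (m + p)).Finite :=
  (hA.finite_mul hB j).subset fun _ hp => ⟨m, _, left_ne_zero_of_mul hp, right_ne_zero_of_mul hp⟩

theorem mul_add_of_bounded (v : Site) [IsUnitStep v] {A B C : Op} (hA : Bounded v A)
    (hB : Bounded v B) (hC : Bounded v C) : A * (B + C) = A * B + A * C := by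
  ext j m
  simp only [add_apply, mul_apply, mul_add]
  exact finsum_add_distrib (hA.finite_support_mul hB j m) (hA.finite_support_mul hC j m)

theorem add_mul_of_bounded (v : Site) [IsUnitStep v] {A B C : Op} (hA : Bounded v A)
    (hB : Bounded v B) (hC : Bounded v C) : (A + B) * C = A * C + B * C := by
  ext j m
  simp only [add_apply, mul_apply, add_mul]
  exact finsum_add_distrib (hA.finite_support_mul hC j m) (hB.finite_support_mul hC j m)

/-- Both bracketings are iterated forms of one double sum over the partial orders `(p, q)`. Its
support is finite by the bounds, so the order of summation may be exchanged. -/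
theorem mul_assoc_of_bounded (v : Site) [IsUnitStep v] {A B C : Op} (hA : Bounded v A)
    (hB : Bounded v B) (hC : Bounded v C) : A * B * C = A * (B * C) := by
  ext j m
  simp only [mul_apply]
  have hfin : (Function.support fun x : Site × Site =>
      A x.1 m * B (x.2 - x.1) (m + x.1) * C (j - x.2) (m + x.2)).Finite := by
    have h1 := (hA.mul hB).finite_mul hC j
    have h2 := hA.finite_mul (hB.mul hC) j
    obtain ⟨a, b, hA⟩ := hA
    obtain ⟨a', b', hB⟩ := hB
    obtain ⟨a'', b'', hC⟩ := hC
    refine ((finite_along_across v a (along v j - a' - a'') (-b) b).prod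
      (finite_along_across v (a + a') (along v j - a'') (-(b + b')) (b + b'))).subset ?_
    rintro ⟨p, q⟩ hpq
    have hC := hC _ _ (right_ne_zero_of_mul hpq)
    have hA := hA _ _ (left_ne_zero_of_mul (left_ne_zero_of_mul hpq))
    have hB := hB _ _ (right_ne_zero_of_mul (left_ne_zero_of_mul hpq))
    simp only [along_sub, across_sub] at hA hB hC
    simp only [Set.mem_prod, Set.mem_ofPred_eq]
    omega
  have hfin' : (Function.support fun x : Site × Site =>
      A x.2 m * B (x.1 - x.2) (m + x.2) * C (j - x.1) (m + x.1)).Finite :=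
    (hfin.preimage (f := Prod.swap) Prod.swap_injective.injOn).subset fun x hx => hx
  calc _ = ∑ᶠ q, ∑ᶠ p, A p m * B (q - p) (m + p) * C (j - q) (m + q) :=
        finsum_congr fun q => finsum_mul _ _
    _ = ∑ᶠ x : Site × Site, A x.2 m * B (x.1 - x.2) (m + x.2) * C (j - x.1) (m + x.1) :=
        (finsum_curry _ hfin').symm
    _ = ∑ᶠ x : Site × Site, A x.1 m * B (x.2 - x.1) (m + x.1) * C (j - x.2) (m + x.2) :=
        finsum_comp_equiv (Equiv.prodComm Site Site)
          (f := fun x => A x.1 m * B (x.2 - x.1) (m + x.1) * C (j - x.2) (m + x.2))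
    _ = ∑ᶠ p, ∑ᶠ q, A p m * B (q - p) (m + p) * C (j - q) (m + q) := finsum_curry _ hfin
    _ = _ := finsum_congr fun p => by
        rw [mul_finsum, ← finsum_comp_equiv (Equiv.addLeft p)]
        refine finsum_congr fun r => ?_
        simp only [Equiv.coe_addLeft, add_sub_cancel_left, mul_assoc, add_assoc, sub_add_eq_sub_sub]

theorem fn_mul_apply (f : Site → TimeField) (A : Op) (j m : Site) :
    (fn f * A) j m = f m * A j m := by
  rw [mul_apply, finsum_eq_single _ 0]
  · simp [fn]
  · intro p hp
    simp [fn, hp]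

theorem mul_fn_apply (A : Op) (f : Site → TimeField) (j m : Site) :
    (A * fn f) j m = A j m * f (m + j) := by
  rw [mul_apply, finsum_eq_single _ j]
  · simp [fn]
  · intro p hp
    simp [fn, sub_eq_zero, hp.symm]

theorem shift_mul_apply (u : Site) (A : Op) (j m : Site) :
    (shift u * A) j m = A (j - u) (m + u) := by
  rw [mul_apply, finsum_eq_single _ u]
  · simp [shift]
  · intro p hp
    simp [shift, hp]

theorem mul_shift_apply (A : Op) (u j m : Site) : (A * shift u) j m = A (j - u) m := by
  rw [mul_apply, finsum_eq_single _ (j - u)]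
  · simp [shift]
  · intro p hp
    have : j - p ≠ u := fun h => hp (by rw [← h]; abel)
    simp [shift, this]

theorem one_eq_fn : (1 : Op) = fn 1 := rfl

theorem one_mul' (A : Op) : 1 * A = A := by
  ext j m
  simp [one_eq_fn, fn_mul_apply]

theorem mul_one' (A : Op) : A * 1 = A := by
  ext j m
  simp [one_eq_fn, mul_fn_apply]

theorem bounded_tderiv {v : Site} (p : Time) {A : Op} (hA : Bounded v A) :
    Bounded v (tderiv p A) := by
  obtain ⟨a, b, hA⟩ := hA
  exact ⟨a, b, fun j m h => hA j m fun h0 => h (by simp [tderiv, h0, timeDeriv_zero])⟩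

theorem tderiv_add (p : Time) (A B : Op) : tderiv p (A + B) = tderiv p A + tderiv p B := by
  ext j m
  simp [tderiv, add_apply, timeDeriv_add]

theorem tderiv_mul_of_bounded (v : Site) [IsUnitStep v] (p : Time) {A B : Op} (hA : Bounded v A)
    (hB : Bounded v B) : tderiv p (A * B) = tderiv p A * B + A * tderiv p B := by
  ext j m
  simp only [tderiv, add_apply, mul_apply]
  rw [show timeDeriv p = timeDerivHom p from rfl,
    AddMonoidHom.map_finsum _ (hA.finite_support_mul hB j m)]
  have h1 := (bounded_tderiv p hA).finite_support_mul hB j m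
  have h2 := hA.finite_support_mul (bounded_tderiv p hB) j m
  simp only [tderiv] at h1 h2
  exact (finsum_congr fun q => timeDeriv_mul p _ _).trans (finsum_add_distrib h1 h2)

end Op

/-- The ring of formal operators with order bounded below along `v` and bounded across `v`. -/
@[ext]
structure OpRing (v : Site) where
  /-- The underlying operator. -/
  val : Op
  bounded : Op.Bounded v val

namespace OpRing

open Op

variable {v : Site} [IsUnitStep v]

instance : Zero (OpRing v) := ⟨⟨0, bounded_zero v⟩⟩
instance : One (OpRing v) := ⟨⟨1, bounded_fn v 1⟩⟩
instance : Add (OpRing v) := ⟨fun A B => ⟨A.1 + B.1, A.2.add B.2⟩⟩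
instance : Neg (OpRing v) := ⟨fun A => ⟨-A.1, A.2.neg⟩⟩
instance : Mul (OpRing v) := ⟨fun A B => ⟨A.1 * B.1, A.2.mul B.2⟩⟩

instance : Ring (OpRing v) where
  add_assoc A B C := OpRing.ext (add_assoc A.1 B.1 C.1)
  zero_add A := OpRing.ext (zero_add A.1)
  add_zero A := OpRing.ext (add_zero A.1)
  add_comm A B := OpRing.ext (add_comm A.1 B.1)
  neg_add_cancel A := OpRing.ext (neg_add_cancel A.1)
  mul_assoc A B C := OpRing.ext (mul_assoc_of_bounded v A.2 B.2 C.2)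
  one_mul A := OpRing.ext (one_mul' A.1)
  mul_one A := OpRing.ext (mul_one' A.1)
  left_distrib A B C := OpRing.ext (mul_add_of_bounded v A.2 B.2 C.2)
  right_distrib A B C := OpRing.ext (add_mul_of_bounded v A.2 B.2 C.2)
  zero_mul A := OpRing.ext (by
    ext j m
    exact (finsum_congr fun p => zero_mul (A.1 (j - p) (m + p))).trans finsum_zero)
  mul_zero A := OpRing.ext (by
    ext j m
    exact (finsum_congr fun p => mul_zero (A.1 p m)).trans finsum_zero)
  nsmul := nsmulRec
  zsmul := zsmulRec

end OpRing

end

end ThreeKP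

/-! ### Series in one shift, projections and inverses in the ring of bounded operators. -/

namespace ThreeKP

noncomputable section

namespace Op

theorem Within.sub {v : Site} {a b : ℤ} {A B : Op} (hA : Within v a b A)
    (hB : Within v a b B) : Within v a b (A - B) := by
  rw [sub_eq_add_neg]
  exact hA.add hB.neg

theorem Within.tderiv {v : Site} {a b : ℤ} {A : Op} (hA : Within v a b A) (p : Time) :
    Within v a b (tderiv p A) := fun j m h =>
  hA j m fun h0 => h (by simp [Op.tderiv, h0, timeDeriv_zero])

theorem within_shift (v u : Site) (h : across v u = 0) : Within v (along v u) 0 (shift u) :=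
  fun j m hj => by
    have : j = u := by
      by_contra h'
      exact hj (by simp [shift, h'])
    rw [this]
    omega

/-- The value at an integer of a sequence extended by zero. -/
def extZero (c : ℕ → TimeField) (n : ℤ) : TimeField := if 0 ≤ n then c n.toNat else 0

theorem extZero_natCast (c : ℕ → TimeField) (n : ℕ) : extZero c n = c n := by simp [extZero]

theorem extZero_of_neg (c : ℕ → TimeField) {n : ℤ} (h : n < 0) : extZero c n = 0 := by
  simp [extZero, h]

theorem series_apply (v : Site) [IsUnitStep v] (c : ℕ → Site → TimeField) (j m : Site) :
    series v c j m = if across v j = 0 then extZero (fun n => c n m) (along v j) else 0 := by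
  unfold series
  split_ifs with h
  · have hj := eq_zsmul_of_across_eq_zero v h
    by_cases h0 : 0 ≤ along v j
    · obtain ⟨n, hn⟩ := Int.eq_ofNat_of_zero_le h0
      rw [hn] at hj
      rw [hn, extZero_natCast, finsum_eq_single _ n]
      · simp [hj]
      · intro k hk
        rw [if_neg]
        rintro rfl
        rw [← natCast_zsmul, along_zsmul] at hn
        omega
    · rw [extZero_of_neg _ (not_le.1 h0)]
      refine (finsum_congr fun n => if_neg ?_).trans finsum_zero
      rintro rfl
      rw [← natCast_zsmul, along_zsmul] at h0
      omega
  · refine (finsum_congr fun n => if_neg ?_).trans finsum_zero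
    rintro rfl
    rw [← natCast_zsmul, across_zsmul] at h
    exact h rfl

theorem within_series (v : Site) [IsUnitStep v] (c : ℕ → Site → TimeField) :
    Within v 0 0 (series v c) := fun j m h => by
  rw [series_apply] at h
  split_ifs at h with h0
  · refine ⟨?_, by omega⟩
    by_contra h1
    exact h (extZero_of_neg _ (not_le.1 h1))
  · exact (h rfl).elim

theorem bounded_series (v : Site) [IsUnitStep v] (c : ℕ → Site → TimeField) :
    Bounded v (series v c) := ⟨0, 0, within_series v c⟩

/-- Terms whose order along `v` satisfies `P`. -/
def partAlong (v : Site) (P : ℤ → Prop) [DecidablePred P] (A : Op) : Op :=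
  fun j m => if P (along v j) then A j m else 0

theorem Within.partAlong {v : Site} {a b : ℤ} {A : Op} (hA : Within v a b A) (P : ℤ → Prop)
    [DecidablePred P] : Within v a b (partAlong v P A) := fun j m h =>
  hA j m fun h0 => h (by simp [Op.partAlong, h0])

theorem bounded_partAlong {v : Site} {A : Op} (hA : Bounded v A) (P : ℤ → Prop)
    [DecidablePred P] : Bounded v (partAlong v P A) := by
  obtain ⟨a, b, hA⟩ := hA
  exact ⟨a, b, hA.partAlong P⟩

theorem Within.mul_zero_across {v : Site} {a a' : ℤ} {A B : Op} (hA : Within v a 0 A)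
    (hB : Within v a' 0 B) : Within v (a + a') 0 (A * B) := by
  simpa using hA.mul hB

theorem within_one (v : Site) : Within v 0 0 (1 : Op) := within_fn v 1

/-- When the left factor lives on the line spanned by `v`, the product at a point of that line
involves only the line, and the sum over the lattice becomes a sum over integers. -/
theorem mul_apply_zsmul {v : Site} [IsUnitStep v] {a : ℤ} {A : Op} (hA : Within v a 0 A) (B : Op)
    (n : ℤ) (m : Site) {s : Finset ℤ}
    (hs : ∀ c, A (c • v) m ≠ 0 → B ((n - c) • v) (m + c • v) ≠ 0 → c ∈ s) :
    (A * B) (n • v) m = ∑ c ∈ s, A (c • v) m * B ((n - c) • v) (m + c • v) := by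
  rw [mul_apply, finsum_eq_sum_of_support_subset (s := s.map ⟨fun c : ℤ => c • v, fun c d h => by
      simpa only [along_zsmul] using congrArg (along v) h⟩)]
  · rw [Finset.sum_map]
    refine Finset.sum_congr rfl fun c _ => ?_
    simp [sub_smul]
  · intro p hp
    have h3 : across v p = 0 := by
      have h1 := hA _ _ (left_ne_zero_of_mul hp)
      omega
    have h4 := eq_zsmul_of_across_eq_zero v h3
    simp only [Finset.coe_map, Set.mem_image, Finset.mem_coe]
    refine ⟨along v p, hs _ ?_ ?_, h4.symm⟩
    · rw [← h4]
      exact left_ne_zero_of_mul hp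
    · rw [sub_smul, ← h4]
      exact right_ne_zero_of_mul hp

end Op

namespace OpRing

open Op

variable {v : Site} [IsUnitStep v]

theorem val_add (A B : OpRing v) : (A + B).1 = A.1 + B.1 := rfl
theorem val_mul (A B : OpRing v) : (A * B).1 = A.1 * B.1 := rfl
theorem val_one : (1 : OpRing v).1 = 1 := rfl
theorem val_sub (A B : OpRing v) : (A - B).1 = A.1 - B.1 := by
  rw [sub_eq_add_neg, sub_eq_add_neg]
  rfl

theorem val_pow (A : OpRing v) (k : ℕ) : (A ^ k).1 = A.1 ^ k := by
  induction k with
  | zero => rw [pow_zero]; rfl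
  | succ k ih =>
    rw [pow_succ, val_mul, ih]
    rfl

/-- The inclusion in the group of all formal operators. -/
def valHom (v : Site) [IsUnitStep v] : OpRing v →+ Op := AddMonoidHom.mk' OpRing.val val_add

theorem val_sum {ι : Type*} (s : Finset ι) (f : ι → OpRing v) :
    (∑ i ∈ s, f i).1 = ∑ i ∈ s, (f i).1 := map_sum (valHom v) f s

/-- `Λ ^ u`. -/
def sh (v u : Site) : OpRing v := ⟨shift u, bounded_shift v u⟩

/-- Multiplication by a function. -/
def mulFn (v : Site) (f : Site → TimeField) : OpRing v := ⟨fn f, bounded_fn v f⟩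

/-- The coefficientwise time derivative. -/
def deriv (p : Time) (A : OpRing v) : OpRing v := ⟨tderiv p A.1, bounded_tderiv p A.2⟩

/-- The terms with order along `v` satisfying `P`. -/
def part (P : ℤ → Prop) [DecidablePred P] (A : OpRing v) : OpRing v :=
  ⟨partAlong v P A.1, bounded_partAlong A.2 P⟩

theorem val_sh (u : Site) : (sh v u).1 = shift u := rfl
theorem val_mulFn (f : Site → TimeField) : (mulFn v f).1 = fn f := rfl
theorem val_deriv (p : Time) (A : OpRing v) : (deriv p A).1 = tderiv p A.1 := rfl
theorem val_part (P : ℤ → Prop) [DecidablePred P] (A : OpRing v) :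
    (part P A).1 = partAlong v P A.1 := rfl

theorem deriv_add (p : Time) (A B : OpRing v) : deriv p (A + B) = deriv p A + deriv p B :=
  OpRing.ext (tderiv_add p A.1 B.1)

theorem deriv_mul (p : Time) (A B : OpRing v) :
    deriv p (A * B) = deriv p A * B + A * deriv p B :=
  OpRing.ext (tderiv_mul_of_bounded v p A.2 B.2)

/-- The time derivative as an additive map. -/
def derivHom (v : Site) [IsUnitStep v] (p : Time) : OpRing v →+ OpRing v :=
  AddMonoidHom.mk' (deriv p) (deriv_add p)

theorem deriv_sub (p : Time) (A B : OpRing v) : deriv p (A - B) = deriv p A - deriv p B :=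
  (derivHom v p).map_sub A B

theorem sh_zero : sh v 0 = 1 := rfl

theorem sh_mul_sh (u w : Site) : sh v u * sh v w = sh v (u + w) := OpRing.ext (by
  ext j m
  rw [val_mul, val_sh, val_sh, shift_mul_apply, val_sh]
  simp [shift, sub_eq_iff_eq_add, add_comm])

theorem deriv_sh (p : Time) (u : Site) : deriv p (sh v u) = 0 := OpRing.ext (by
  ext j m
  simp only [deriv, tderiv, sh, shift]
  split_ifs
  · exact timeDeriv_one p
  · exact timeDeriv_zero p)

theorem deriv_one (p : Time) : deriv p (1 : OpRing v) = 0 := deriv_sh p 0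

theorem sh_commute (u w : Site) : Commute (sh v u) (sh v w) := by
  rw [Commute, SemiconjBy, sh_mul_sh, sh_mul_sh, add_comm]

theorem sh_mul_neg (u : Site) : sh v u * sh v (-u) = 1 := by
  rw [sh_mul_sh, add_neg_cancel, sh_zero]

theorem sh_neg_mul (u : Site) : sh v (-u) * sh v u = 1 := by
  rw [sh_mul_sh, neg_add_cancel, sh_zero]

theorem sh_pow (u : Site) (k : ℕ) : sh v u ^ k = sh v (k • u) := by
  induction k with
  | zero => simp [sh_zero]
  | succ k ih => rw [pow_succ, ih, sh_mul_sh, succ_nsmul]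

theorem mulFn_mul_mulFn (f g : Site → TimeField) : mulFn v f * mulFn v g = mulFn v (f * g) :=
  OpRing.ext (by
    ext j m
    rw [val_mul, val_mulFn, val_mulFn, fn_mul_apply, val_mulFn]
    simp [fn])

theorem mulFn_one : mulFn v 1 = 1 := rfl

theorem part_sh_conj (P : ℤ → Prop) [DecidablePred P] (A : OpRing v) (u : Site) :
    part P (sh v u * A * sh v (-u)) = sh v u * part P A * sh v (-u) := OpRing.ext (by
  ext j m
  simp only [val_part, partAlong, val_mul, val_sh, mul_shift_apply, shift_mul_apply, sub_neg_eq_add,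
    add_sub_cancel_right])

/-- The operator `∑ c_n Q ^ n`, `Q = Λ ^ v`. -/
def ser (v : Site) [IsUnitStep v] (c : ℕ → Site → TimeField) : OpRing v :=
  ⟨series v c, bounded_series v c⟩

theorem val_ser (c : ℕ → Site → TimeField) : (ser v c).1 = series v c := rfl

theorem eq_ser (A : OpRing v) (h : Within v 0 0 A.1) : A = ser v fun n => A.1 (n • v) := OpRing.ext (by
  ext j m
  rw [val_ser, series_apply]
  split_ifs with h0
  · have hj := eq_zsmul_of_across_eq_zero v h0
    by_cases h1 : 0 ≤ along v j
    · obtain ⟨n, hn⟩ := Int.eq_ofNat_of_zero_le h1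
      rw [hn] at hj
      rw [hn, extZero_natCast, hj, natCast_zsmul]
    · rw [extZero_of_neg _ (not_le.1 h1)]
      by_contra h2
      exact h1 (h j m h2).1
  · by_contra h2
    have := h j m h2
    omega)

theorem series_nsmul (c : ℕ → Site → TimeField) (n : ℕ) (m : Site) :
    series v c (n • v) m = c n m := by
  rw [series_apply, ← natCast_zsmul, across_zsmul, along_zsmul, if_pos rfl, extZero_natCast]

theorem ser_ext {c d : ℕ → Site → TimeField} (h : ∀ n m, c n m = d n m) : ser v c = ser v d := by
  rw [show c = d from funext fun n => funext (h n)]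

theorem invCoeff_ser_mul (c : ℕ → Site → TimeField) (h : ∀ m, c 0 m ≠ 0) :
    ser v (invCoeff v c) * ser v c = 1 := by
  rw [eq_ser (ser v (invCoeff v c) * ser v c)
    ((within_series v _).mul_zero_across (within_series v _)),
    eq_ser (1 : OpRing v) (within_one v)]
  refine ser_ext fun n m => ?_
  rw [val_mul, val_ser, val_ser, ← natCast_zsmul,
    mul_apply_zsmul (within_series v _) _ n m
      (s := (Finset.range (n + 1)).map Nat.castEmbedding)]
  · rw [Finset.sum_map, Finset.sum_range_succ, ← Fin.sum_univ_eq_sum_range]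
    simp only [Nat.castEmbedding_apply, sub_self, natCast_zsmul]
    have h1 : ∀ p : Fin n, series v c (((n : ℤ) - (p : ℕ)) • v) (m + (p : ℕ) • v) =
        c (n - p) (m + (p : ℕ) • v) := fun p => by
      rw [← Nat.cast_sub p.2.le, natCast_zsmul, series_nsmul]
    have h2 : series v c ((0 : ℤ) • v) (m + n • v) = c 0 (m + n • v) := by
      simpa using series_nsmul (v := v) c 0 (m + n • v)
    simp only [h1, h2, series_nsmul]
    conv_lhs => enter [2]; rw [invCoeff]
    rw [div_mul_cancel₀ _ (h _), add_sub_cancel, val_one, one_apply]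
    refine if_congr ⟨?_, ?_⟩ rfl rfl
    · rintro rfl
      exact zero_smul ℕ v
    · intro h3
      have := along_zsmul v n
      rw [natCast_zsmul, h3, along_zero] at this
      omega
  · intro c h1 h2
    have hc := (within_series v _ _ _ h1).1
    have hc' := (within_series v _ _ _ h2).1
    rw [along_zsmul] at hc hc'
    simp only [Finset.mem_map, Finset.mem_range, Nat.castEmbedding_apply]
    exact ⟨c.toNat, by omega, by omega⟩

/-- The recursion yields only left inverses. The left inverse again has a leading coefficient
without zeros, so it has a left inverse of its own, which must then be the original series. -/
theorem ser_mul_invCoeff (c : ℕ → Site → TimeField) (h : ∀ m, c 0 m ≠ 0) :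
    ser v c * ser v (invCoeff v c) = 1 := by
  have h1 := invCoeff_ser_mul (v := v) c h
  have h0 : ∀ m, invCoeff v c 0 m ≠ 0 := fun m => by
    rw [invCoeff]
    simpa using h m
  have h2 := invCoeff_ser_mul (v := v) _ h0
  have h3 := left_inv_eq_right_inv h2 h1
  rwa [h3] at h2

/-- The inverse of an operator on the line along `v` with a leading coefficient at order `N`. -/
def inverse (N : ℤ) (A : OpRing v) : OpRing v :=
  sh v (-(N • v)) * ser v (invCoeff v fun n => A.1 ((N + n) • v))

theorem val_inverse (N : ℤ) (A : OpRing v) : (inverse N A).1 = inv v N A.1 := rfl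

theorem eq_ser_mul_sh {N : ℤ} {A : OpRing v} (h : Within v N 0 A.1) :
    A = ser v (fun n => A.1 ((N + n) • v)) * sh v (N • v) := by
  have h1 : Within v 0 0 (A * sh v (-(N • v))).1 := by
    have := h.mul_zero_across (within_shift v (-(N • v))
      (by rw [← neg_smul, across_zsmul]))
    rw [← neg_smul, along_zsmul, add_neg_cancel] at this
    rw [← neg_smul]
    exact this
  have h2 := eq_ser _ h1
  have h3 : ser v (fun n => (A * sh v (-(N • v))).1 (n • v)) =
      ser v (fun n => A.1 ((N + n) • v)) := by
    refine ser_ext fun n m => ?_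
    rw [val_mul, val_sh, mul_shift_apply, sub_neg_eq_add, add_smul, natCast_zsmul, add_comm]
  rw [← h3, ← h2, mul_assoc, sh_neg_mul, mul_one]

theorem inverse_mul {N : ℤ} {A : OpRing v} (h : Within v N 0 A.1)
    (h0 : ∀ m, A.1 (N • v) m ≠ 0) : inverse N A * A = 1 := by
  conv_lhs => enter [2]; rw [eq_ser_mul_sh h]
  rw [inverse, mul_assoc, ← mul_assoc (ser v _), invCoeff_ser_mul _ (by simpa using h0), one_mul,
    sh_neg_mul]

theorem mul_inverse {N : ℤ} {A : OpRing v} (h : Within v N 0 A.1)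
    (h0 : ∀ m, A.1 (N • v) m ≠ 0) : A * inverse N A = 1 := by
  conv_lhs => enter [1]; rw [eq_ser_mul_sh h]
  rw [inverse, mul_assoc, ← mul_assoc (sh v _), sh_mul_neg, one_mul,
    ser_mul_invCoeff _ (by simpa using h0)]

end OpRing

end

end ThreeKP

/-! ### Dressing, conjugation of Lax operators, and positive parts in powers of `Q⁻¹ - 1`. -/

namespace ThreeKP

noncomputable section

namespace OpRing

open Op

variable {v : Site} [IsUnitStep v]

/-- If `T S = K X S Y` and `S` evolves by `∂ S = B S - S E`, then `T` evolves by
`∂ T = C T - T B`, where `C K X = K X B`. -/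
theorem deriv_eq_of_dressing (p : Time) {F Y S S' T E B C : OpRing v} (hrel : F * S * Y = T * S)
    (hS : deriv p S = B * S - S * E) (hEY : E * Y = Y * E) (hC : C * F = F * B)
    (hF : deriv p F = 0) (hY : deriv p Y = 0) (hS' : S * S' = 1) :
    deriv p T = C * T - T * B := by
  have h := congrArg (deriv p) hrel
  rw [deriv_mul, deriv_mul, deriv_mul, hF, hY, hS, zero_mul, zero_add, mul_zero, add_zero] at h
  -- `F` is moved past `B` at the price of turning `B` into `C`, and `E` is moved past `Y`; both
  -- terms then contain `F S Y = T S`.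
  have h1 : F * (B * S - S * E) * Y = C * (T * S) - T * S * E := by
    rw [← hrel, mul_sub, sub_mul, ← mul_assoc F B S, ← hC]
    simp only [mul_assoc, hEY]
  rw [h1] at h
  have h2 : deriv p T * S = (C * T - T * B) * S := by
    rw [← sub_eq_iff_eq_add] at h
    rw [← h]
    noncomm_ring
  calc deriv p T = deriv p T * S * S' := by rw [mul_assoc, hS', mul_one]
    _ = _ := by rw [h2, mul_assoc, hS', mul_one]

/-- If `T S = F S Y` and `E` commutes with `Y`, then conjugation of `S E ^ k S⁻¹` by `T` is the
same as conjugation by `F`. -/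
theorem conj_lax_eq {F F' Y Y' S S' T T' E : OpRing v} (hrel : F * S * Y = T * S)
    (hEY : E * Y = Y * E) (hYY' : Y * Y' = 1) (hFF' : F * F' = 1) (hS : S' * S = 1)
    (hS' : S * S' = 1) (hT'T : T' * T = 1) (k : ℕ) :
    T * (S * E * S') ^ k * T' = F * (S * E * S') ^ k * F' := by
  have hpow : (S * E * S') ^ k = S * E ^ k * S' := by
    induction k with
    | zero => simp [hS']
    | succ k ih =>
      rw [pow_succ, ih, pow_succ]
      simp only [mul_assoc]
      rw [← mul_assoc S' S, hS, one_mul]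
  have hEY' : E ^ k * Y = Y * E ^ k := (show Commute E Y from hEY).pow_left k
  -- With `T = F (S Y S⁻¹)`, the middle factor commutes with `S E S⁻¹` and cancels in the
  -- conjugation.
  have hT : T = F * S * Y * S' := by rw [hrel, mul_assoc, hS', mul_one]
  have hT' : T' = S * Y' * S' * F' := by
    refine left_inv_eq_right_inv hT'T ?_
    rw [hT]
    simp only [mul_assoc]
    rw [← mul_assoc S' S, hS, one_mul, ← mul_assoc Y Y', hYY', one_mul, ← mul_assoc S S', hS',
      one_mul, hFF']
  rw [hpow, hT', hT]
  simp only [mul_assoc]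
  rw [← mul_assoc S' S, hS, one_mul, ← mul_assoc S' S, hS, one_mul, ← mul_assoc Y (E ^ k),
    ← hEY', mul_assoc (E ^ k), ← mul_assoc Y Y', hYY', one_mul]

/-- `1 - Q`, `Q = Λ ^ v`. -/
def oneSub (v : Site) [IsUnitStep v] : OpRing v := 1 - sh v v

/-- `(1 - Q)⁻¹ = ∑ Q ^ n`, `Q = Λ ^ v`. -/
def oneSubInv (v : Site) [IsUnitStep v] : OpRing v := ser v fun _ _ => 1

theorem mul_oneSub_apply (A : OpRing v) (j m : Site) :
    (A * oneSub v).1 j m = A.1 j m - A.1 (j - v) m := by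
  rw [oneSub, mul_sub, mul_one, val_sub, sub_apply, val_mul, val_sh, mul_shift_apply]

theorem oneSub_mul_apply (A : OpRing v) (j m : Site) :
    (oneSub v * A).1 j m = A.1 j m - A.1 (j - v) (m + v) := by
  rw [oneSub, sub_mul, one_mul, val_sub, sub_apply, val_mul, val_sh, shift_mul_apply]

theorem across_self (v : Site) : across v v = 0 := by simpa using across_zsmul v 1
theorem along_self (v : Site) [IsUnitStep v] : along v v = 1 := by simpa using along_zsmul v 1

theorem oneSubInv_sub_self (j m : Site) :
    (oneSubInv v).1 j m - (oneSubInv v).1 (j - v) m = (1 : OpRing v).1 j m := by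
  rw [oneSubInv, val_ser, series_apply, series_apply, val_one, one_apply, across_sub, along_sub,
    across_self, along_self, sub_zero]
  split_ifs with h1 h2 h2
  · simp [h2, extZero]
  · have h3 : along v j ≠ 0 := fun h3 => h2 (by
      rw [eq_zsmul_of_across_eq_zero v h1, h3, zero_smul])
    simp only [extZero]
    split_ifs <;> first | omega | simp
  · simp [h2] at h1
  · simp

theorem oneSubInv_mul : oneSubInv v * oneSub v = 1 := OpRing.ext (by
  ext j m
  rw [mul_oneSub_apply, oneSubInv_sub_self])

theorem oneSub_mul_inv : oneSub v * oneSubInv v = 1 := OpRing.ext (by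
  ext j m
  rw [oneSub_mul_apply, ← oneSubInv_sub_self]
  simp [oneSubInv, val_ser, series_apply])

theorem within_oneSub : Within v 0 0 (oneSub v).1 := by
  rw [oneSub, val_sub]
  exact (within_one v).sub (((within_shift v v (across_self v)).mono
    (by rw [along_self]; omega) le_rfl))

theorem sh_mul_oneSub (u : Site) : sh v u * oneSub v = oneSub v * sh v u := by
  rw [oneSub, mul_sub, sub_mul, sh_commute u v, mul_one, one_mul]

theorem sh_mul_oneSubInv (u : Site) : sh v u * oneSubInv v = oneSubInv v * sh v u := by
  calc sh v u * oneSubInv v = oneSubInv v * (oneSub v * sh v u) * oneSubInv v := by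
        rw [← mul_assoc, oneSubInv_mul, one_mul]
    _ = _ := by rw [← sh_mul_oneSub, mul_assoc, mul_assoc, oneSub_mul_inv, mul_one]

theorem deriv_oneSub (p : Time) : deriv p (oneSub v) = 0 := by
  rw [oneSub, deriv_sub, deriv_one, deriv_sh, sub_zero]

/-- `N_{≤ 0} - ((1 - Q)⁻¹ N)_{[0]} = (1 - Q) ((1 - Q)⁻¹ N)_{< 0}`. -/
theorem part_nonpos_sub (N : OpRing v) :
    part (fun j => j ≤ 0) N - part (fun j => j = 0) (oneSubInv v * N) =
      oneSub v * part (fun j => j < 0) (oneSubInv v * N) := OpRing.ext (by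
  ext j m
  -- Writing `N = (1 - Q) M` turns each coefficient of `N` into a difference of two coefficients of
  -- `M`. Truncating `M` to negative orders changes this difference at order zero only, where the
  -- term of order zero of `M` is lost.
  have h : N.1 j m = (oneSubInv v * N).1 j m - (oneSubInv v * N).1 (j - v) (m + v) := by
    rw [← oneSub_mul_apply, ← mul_assoc, oneSub_mul_inv, one_mul]
  rw [oneSub_mul_apply, val_sub, sub_apply]
  simp only [val_part, partAlong, along_sub, along_self, h]
  split_ifs <;> first | omega | simp)

theorem val_sum_apply {ι : Type*} (s : Finset ι) (f : ι → OpRing v) (j m : Site) :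
    (∑ i ∈ s, f i).1 j m = ∑ i ∈ s, (f i).1 j m :=
  map_sum ((coeffHom j m).comp (valHom v)) f s

/-- `∑_n A_{-n} (Q ^ (-n) - 1) = (A (1 - Q)⁻¹)_{< 0} (1 - Q)`. -/
theorem sum_coeff_mul_sh_sub_one (A : OpRing v) (N : ℕ) (hA : Within v (-N) 0 A.1) :
    ∑ n ∈ Finset.range (N + 1), mulFn v (A.1 ((-n : ℤ) • v)) * (sh v ((-n : ℤ) • v) - 1) =
      part (fun j => j < 0) (A * oneSubInv v) * oneSub v := OpRing.ext (by
  ext j m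
  set G := A * oneSubInv v with hG
  have hGw : Within v (-N) 0 G.1 := by
    have := hA.mul_zero_across (within_series v fun _ _ => 1)
    rwa [add_zero] at this
  -- The coefficients of `A` are differences of those of `G = A (1 - Q)⁻¹`, so their sums telescope.
  have h : ∀ j m, A.1 j m = G.1 j m - G.1 (j - v) m := fun j m => by
    rw [← mul_oneSub_apply, hG, mul_assoc, oneSubInv_mul, mul_one]
  rw [mul_oneSub_apply, val_sum_apply]
  have hterm : ∀ n ∈ Finset.range (N + 1),
      (mulFn v (A.1 ((-n : ℤ) • v)) * (sh v ((-n : ℤ) • v) - 1)).1 j m =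
        (if j = (-n : ℤ) • v then A.1 j m else 0) -
          if j = 0 then A.1 ((-n : ℤ) • v) m else 0 := fun n _ => by
    rw [val_mul, val_mulFn, fn_mul_apply, val_sub, Op.sub_apply, val_sh, val_one, one_apply, shift,
      mul_sub, mul_ite, mul_ite, mul_one, mul_zero]
    congr 1
    split_ifs with h1
    · rw [h1]
    · rfl
  rw [Finset.sum_congr rfl hterm, Finset.sum_sub_distrib]
  simp only [val_part, partAlong, along_sub, along_self]
  by_cases hj : across v j = 0
  · have hj' := eq_zsmul_of_across_eq_zero v hj
    have h0 : j = 0 ↔ along v j = 0 := ⟨fun h => by rw [h, along_zero],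
      fun h => by rw [hj', h, zero_smul]⟩
    have hn : ∀ n : ℕ, j = (-n : ℤ) • v ↔ along v j = -n := fun n =>
      ⟨fun h => by rw [h, along_zsmul], fun h => by rw [hj', h]⟩
    rcases lt_trichotomy (along v j) 0 with hl | hl | hl
    · have h1 : ¬ j = 0 := by rw [h0]; omega
      rw [if_pos hl, if_pos (by omega), ← h]
      simp only [h1, if_false, Finset.sum_const_zero, sub_zero]
      by_cases hN : -(N : ℤ) ≤ along v j
      · rw [Finset.sum_eq_single (-along v j).toNat]
        · rw [if_pos ((hn _).2 (by omega))]
        · intro n _ hne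
          exact if_neg fun h2 => hne (by have := (hn n).1 h2; omega)
        · intro h2
          rw [Finset.mem_range] at h2
          omega
      · have : A.1 j m = 0 := by
          by_contra h2
          exact hN (hA j m h2).1
        simp [this]
    -- At order zero the term `n = 0` cancels, and the terms `n ≥ 1` telescope to the coefficient of
    -- `G` of order `-1`; the other end, at order `-(N + 1)`, lies below the support of `G`.
    · rw [if_neg (by omega), if_pos (by omega)]
      have h1 := h0.2 hl
      subst h1
      simp only [if_true]
      rw [Finset.sum_range_succ', Finset.sum_range_succ']
      have h2 : ∀ n : ℕ, ¬ (0 : Site) = (-((n + 1 : ℕ) : ℤ)) • v := fun n h2 => by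
        have := (hn (n + 1)).1 h2
        omega
      simp only [h2, if_false, Finset.sum_const_zero, Nat.cast_zero, neg_zero, zero_smul, if_true,
        zero_add]
      have h3 : ∀ n ∈ Finset.range N, A.1 ((-((n + 1 : ℕ) : ℤ)) • v) m =
          G.1 ((-((n + 1 : ℕ) : ℤ)) • v) m - G.1 ((-((n + 1 + 1 : ℕ) : ℤ)) • v) m :=
        fun n _ => by
          rw [h]
          congr 2
          push_cast
          module
      rw [Finset.sum_congr rfl h3,
        Finset.sum_range_sub' fun n : ℕ => G.1 ((-((n + 1 : ℕ) : ℤ)) • v) m]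
      have h4 : G.1 ((-((N + 1 : ℕ) : ℤ)) • v) m = 0 := by
        by_contra h5
        have := (hGw _ _ h5).1
        rw [along_zsmul] at this
        push_cast at this
        omega
      rw [h4]
      simp
    · rw [if_neg (by omega), if_neg (by omega)]
      have h1 : ¬ j = 0 := by rw [h0]; omega
      simp only [h1, if_false, Finset.sum_const_zero, sub_zero]
      refine Finset.sum_eq_zero fun n _ => if_neg ?_
      rw [hn]
      omega
  · have h1 : ¬ j = 0 := fun h1 => hj (by rw [h1, across_zero])
    have h2 : ∀ n : ℕ, ¬ j = (-n : ℤ) • v := fun n h2 => hj (by rw [h2, across_zsmul])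
    have h3 : G.1 j m = 0 := by
      by_contra h3
      have := hGw _ _ h3
      omega
    have h4 : G.1 (j - v) m = 0 := by
      by_contra h4
      have := hGw _ _ h4
      rw [across_sub, across_self] at this
      omega
    simp only [h1, h2, h3, h4, if_false, ite_self, Finset.sum_const_zero, sub_zero])

/-- The part of positive order in `Q⁻¹ - 1` of an operator on the line along `v`. -/
theorem sum_choose_mul_pow (A : OpRing v) (N : ℕ) (hA : Within v (-N) 0 A.1) :
    ∑ q ∈ Finset.range N, (∑ n ∈ Finset.range (N + 1),
        n.choose (q + 1) • mulFn v (A.1 ((-n : ℤ) • v))) * (sh v (-v) - 1) ^ (q + 1) =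
      part (fun j => j < 0) (A * oneSubInv v) * oneSub v := by
  rw [← sum_coeff_mul_sh_sub_one A N hA]
  simp only [Finset.sum_mul]
  rw [Finset.sum_comm]
  refine Finset.sum_congr rfl fun n hn => ?_
  rw [Finset.mem_range] at hn
  -- The binomial theorem for `Q ^ (-n)`: the subtracted `1` is its term `q = 0`, so exactly the
  -- positive powers of `Q⁻¹ - 1` remain.
  have h1 : sh v ((-n : ℤ) • v) = ((sh v (-v) - 1) + 1) ^ n := by
    rw [sub_add_cancel, sh_pow, neg_smul, natCast_zsmul, neg_nsmul]
  rw [h1, (Commute.one_right _).add_pow]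
  have h2 : ∑ q ∈ Finset.range (n + 1), (sh v (-v) - 1) ^ q * 1 ^ (n - q) * (n.choose q : OpRing v)
      = ∑ q ∈ Finset.range (N + 1), n.choose q • (sh v (-v) - 1) ^ q := by
    rw [← Finset.sum_subset (Finset.range_mono (by omega : n + 1 ≤ N + 1))]
    · refine Finset.sum_congr rfl fun q _ => ?_
      rw [one_pow, mul_one, nsmul_eq_mul, Nat.cast_comm]
    · intro q _ hq
      rw [Finset.mem_range] at hq
      rw [Nat.choose_eq_zero_of_lt (by omega), zero_smul]
  rw [h2, Finset.sum_range_succ', Nat.choose_zero_right, one_smul, pow_zero, add_sub_cancel_right,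
    Finset.mul_sum]
  refine Finset.sum_congr rfl fun q _ => ?_
  rw [smul_mul_assoc, mul_smul_comm]

end OpRing

end

end ThreeKP

namespace ThreeKP

noncomputable section

/-! ### The bilinear equation and its first derivatives on the diagonal `t' = t` -/

instance : Filter.TendstoCofinite (Sum.elim id id : Time ⊕ Time → Time) := by
  rw [Filter.tendstoCofinite_iff_finite_preimage_singleton]
  intro p
  refine Set.Finite.subset (Set.toFinite {Sum.inl p, Sum.inr p}) ?_
  rintro (q | q) hq <;> simp_all

/-- The restriction `t' = t`. -/
def merge : TwoTimeSeries →ₐ[ℂ] TimeSeries := MvPowerSeries.rename (Sum.elim id id)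

theorem merge_rename_inl (f : TimeSeries) : merge (MvPowerSeries.rename Sum.inl f) = f := by
  rw [merge, MvPowerSeries.rename_rename]
  exact MvPowerSeries.rename_id_apply f

theorem merge_rename_inr (f : TimeSeries) : merge (MvPowerSeries.rename Sum.inr f) = f := by
  rw [merge, MvPowerSeries.rename_rename]
  exact MvPowerSeries.rename_id_apply f

theorem merge_X_inl (p : Time) : merge (MvPowerSeries.X (Sum.inl p)) = MvPowerSeries.X p :=
  MvPowerSeries.rename_X _ _

theorem merge_X_inr (p : Time) : merge (MvPowerSeries.X (Sum.inr p)) = MvPowerSeries.X p :=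
  MvPowerSeries.rename_X _ _

theorem pderiv_inl_rename_inl (p : Time) (f : TimeSeries) :
    MvPowerSeries.pderiv ℂ (Sum.inl p) (MvPowerSeries.rename Sum.inl f : TwoTimeSeries) =
      MvPowerSeries.rename Sum.inl (MvPowerSeries.pderiv ℂ p f) := by
  classical
  ext d
  rw [MvPowerSeries.coeff_pderiv]
  by_cases hd : d ∈ Set.range (Finsupp.mapDomain (Sum.inl : Time → Time ⊕ Time))
  · obtain ⟨x, rfl⟩ := hd
    have h : ∀ (y : Time →₀ ℕ) (g : TimeSeries),
        MvPowerSeries.coeff (Finsupp.mapDomain (Sum.inl : Time → Time ⊕ Time) y)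
          (MvPowerSeries.rename Sum.inl g) = MvPowerSeries.coeff y g := fun y g => by
      rw [← MvPowerSeries.coeff_embDomain_rename (Function.Embedding.inl (β := Time)) g y,
        Finsupp.embDomain_eq_mapDomain]
      rfl
    rw [← Finsupp.mapDomain_single, ← Finsupp.mapDomain_add, h, h, MvPowerSeries.coeff_pderiv,
      Finsupp.mapDomain_apply Sum.inl_injective]
  · rw [MvPowerSeries.coeff_rename_eq_zero _ _ hd, MvPowerSeries.coeff_rename_eq_zero, zero_mul]
    rintro ⟨x, hx⟩
    -- If raising the exponent of an unprimed time gives a monomial in unprimed times alone, the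
    -- monomial was already of that kind.
    refine hd ⟨x - Finsupp.single p 1, ?_⟩
    ext y
    have hy := DFunLike.congr_fun hx y
    rcases y with y | y
    · rw [Finsupp.mapDomain_apply Sum.inl_injective] at hy ⊢
      rw [Finsupp.tsub_apply, hy, Finsupp.add_apply, Finsupp.single_apply, Finsupp.single_apply]
      by_cases h : p = y <;> simp [h]
    · have h1 : (Sum.inr y : Time ⊕ Time) ∉ Set.range (Sum.inl : Time → Time ⊕ Time) := by simp
      rw [Finsupp.mapDomain_of_notMem_range _ _ h1] at hy ⊢
      simp at hy
      exact hy

theorem pderiv_inl_rename_inr (p : Time) (f : TimeSeries) :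
    MvPowerSeries.pderiv ℂ (Sum.inl p) (MvPowerSeries.rename Sum.inr f : TwoTimeSeries) = 0 := by
  ext d
  rw [MvPowerSeries.coeff_pderiv, MvPowerSeries.coeff_rename_eq_zero, zero_mul, map_zero]
  rintro ⟨x, hx⟩
  have hy := DFunLike.congr_fun hx (Sum.inl p)
  have h1 : (Sum.inl p : Time ⊕ Time) ∉ Set.range (Sum.inr : Time → Time ⊕ Time) := by simp
  rw [Finsupp.mapDomain_of_notMem_range _ _ h1] at hy
  simp at hy

/-- The weight of a monomial in `t, t'`, the times `t_k` and `t'_k` having weight `k`. -/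
def timeWeight (d : Time ⊕ Time →₀ ℕ) : ℕ :=
  Finsupp.weight (Sum.elim (fun p : Time => (p.2 : ℕ)) fun p : Time => (p.2 : ℕ)) d

theorem timeWeight_add (d e : Time ⊕ Time →₀ ℕ) :
    timeWeight (d + e) = timeWeight d + timeWeight e := map_add _ _ _

/-- All monomials of `F` have weight at least `n`. -/
def WeightGE (n : ℕ) (F : TwoTimeSeries) : Prop :=
  ∀ d, timeWeight d < n → MvPowerSeries.coeff d F = 0

theorem WeightGE.mul {n k : ℕ} {F G : TwoTimeSeries} (hF : WeightGE n F) (hG : WeightGE k G) :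
    WeightGE (n + k) (F * G) := fun d hd => by
  classical
  rw [MvPowerSeries.coeff_mul]
  refine Finset.sum_eq_zero fun x hx => ?_
  rw [Finset.HasAntidiagonal.mem_antidiagonal] at hx
  rw [← hx, timeWeight_add] at hd
  by_cases h : timeWeight x.1 < n
  · rw [hF _ h, zero_mul]
  · rw [hG _ (by omega), mul_zero]

theorem WeightGE.sum {ι : Type*} {n : ℕ} {s : Finset ι} {F : ι → TwoTimeSeries}
    (h : ∀ i ∈ s, WeightGE n (F i)) : WeightGE n (∑ i ∈ s, F i) := fun d hd => by
  rw [map_sum]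
  exact Finset.sum_eq_zero fun i hi => h i hi d hd

theorem weightGE_X (n : ℕ) (x : Time ⊕ Time)
    (h : n = Sum.elim (fun p : Time => (p.2 : ℕ)) (fun p : Time => (p.2 : ℕ)) x) :
    WeightGE n (MvPowerSeries.X x) := fun d hd => by
  classical
  rw [MvPowerSeries.coeff_X, if_neg]
  rintro rfl
  rw [timeWeight, Finsupp.weight_single, ← h] at hd
  simp at hd

theorem weightGE_coeff_xiDiff (i : Fin 3) (n : ℕ) :
    WeightGE n (PowerSeries.coeff n (xiDiff i)) := by
  rw [xiDiff, PowerSeries.coeff_mk]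
  split_ifs with h
  · intro d hd
    rw [map_sub, weightGE_X n (Sum.inl (i, ⟨n, h⟩)) rfl d hd,
      weightGE_X n (Sum.inr (i, ⟨n, h⟩)) rfl d hd, sub_zero]
  · exact fun d _ => map_zero _

theorem weightGE_coeff_xiDiff_pow (i : Fin 3) (r n : ℕ) :
    WeightGE n (PowerSeries.coeff n (xiDiff i ^ r)) := by
  induction r generalizing n with
  | zero =>
    rw [pow_zero, PowerSeries.coeff_one]
    split_ifs with h
    · intro d hd
      omega
    · exact fun d _ => map_zero _
  | succ r ih =>
    rw [pow_succ, PowerSeries.coeff_mul]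
    refine WeightGE.sum fun x hx => ?_
    rw [Finset.HasAntidiagonal.mem_antidiagonal] at hx
    rw [← hx]
    exact (ih x.1).mul (weightGE_coeff_xiDiff i x.2)

/-- This makes the infinite sums over `n` in the residues legitimate: a monomial of weight `M` meets
only the terms with `n ≤ M`. -/
theorem weightGE_expXi (i : Fin 3) (n : ℕ) : WeightGE n (expXi i n) :=
  WeightGE.sum fun r _ d hd => by
    rw [MvPowerSeries.coeff_smul, weightGE_coeff_xiDiff_pow i r n d hd, mul_zero]

theorem merge_coeff_xiDiff (i : Fin 3) (n : ℕ) :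
    merge (PowerSeries.coeff n (xiDiff i)) = 0 := by
  rw [xiDiff, PowerSeries.coeff_mk]
  split_ifs
  · rw [map_sub, merge_X_inl, merge_X_inr, sub_self]
  · exact map_zero _

theorem merge_coeff_xiDiff_pow_succ (i : Fin 3) (r n : ℕ) :
    merge (PowerSeries.coeff n (xiDiff i ^ (r + 1))) = 0 := by
  rw [pow_succ, PowerSeries.coeff_mul, map_sum]
  exact Finset.sum_eq_zero fun x _ => by rw [map_mul, merge_coeff_xiDiff, mul_zero]

/-- At `t' = t` the exponent `ξ` vanishes, so only its zeroth power survives. -/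
theorem merge_expXi (i : Fin 3) (n : ℕ) : merge (expXi i n) = if n = 0 then 1 else 0 := by
  rw [expXi, Finset.sum_range_succ', map_add, map_sum, Finset.sum_eq_zero, zero_add, pow_zero,
    PowerSeries.coeff_one]
  · split_ifs <;> simp
  · intro r _
    rw [map_smul, merge_coeff_xiDiff_pow_succ, smul_zero]

/-- The derivative with respect to a time `t`, restricted to `t' = t`. -/
def mergeDeriv (p : Time) (F : TwoTimeSeries) : TimeSeries :=
  merge (MvPowerSeries.pderiv ℂ (Sum.inl p) F)

theorem mergeDeriv_mul (p : Time) (F G : TwoTimeSeries) :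
    mergeDeriv p (F * G) = mergeDeriv p F * merge G + merge F * mergeDeriv p G := by
  simp only [mergeDeriv, Derivation.leibniz, smul_eq_mul, map_add, map_mul]
  ring

theorem mergeDeriv_sum {ι : Type*} (p : Time) (s : Finset ι) (F : ι → TwoTimeSeries) :
    mergeDeriv p (∑ i ∈ s, F i) = ∑ i ∈ s, mergeDeriv p (F i) := by
  simp only [mergeDeriv, map_sum]

theorem mergeDeriv_smul (p : Time) (c : ℂ) (F : TwoTimeSeries) :
    mergeDeriv p (c • F) = c • mergeDeriv p F := by
  rw [mergeDeriv, Derivation.map_smul, map_smul, mergeDeriv]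

theorem coeff_xiDiff_zero (i : Fin 3) : PowerSeries.coeff 0 (xiDiff i) = 0 := by
  simp [xiDiff]

theorem coeff_xiDiff_pnat (i : Fin 3) (k : ℕ+) : PowerSeries.coeff (k : ℕ) (xiDiff i) =
    MvPowerSeries.X (Sum.inl (i, k)) - MvPowerSeries.X (Sum.inr (i, k)) := by
  rw [xiDiff, PowerSeries.coeff_mk, dif_pos k.pos]
  rfl

theorem mergeDeriv_coeff_xiDiff (p : Time) (i : Fin 3) (n : ℕ) :
    mergeDeriv p (PowerSeries.coeff n (xiDiff i)) =
      if i = p.1 ∧ n = (p.2 : ℕ) then 1 else 0 := by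
  rcases n.eq_zero_or_pos with rfl | hn
  · have := p.2.pos
    rw [coeff_xiDiff_zero, if_neg (by omega)]
    simp [mergeDeriv]
  · obtain ⟨k, rfl⟩ : ∃ k : ℕ+, (k : ℕ) = n := ⟨⟨n, hn⟩, rfl⟩
    rw [coeff_xiDiff_pnat, mergeDeriv, map_sub, MvPowerSeries.pderiv_X_of_ne (j := Sum.inr (i, k)) (by simp), sub_zero]
    split_ifs with h
    · rw [show (i, k) = p from Prod.ext h.1 (PNat.coe_inj.1 h.2), MvPowerSeries.pderiv_X_self,
        map_one]
    · rw [MvPowerSeries.pderiv_X_of_ne, map_zero]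
      intro h2
      rw [Sum.inl.injEq] at h2
      exact h (by rw [← h2]; exact ⟨rfl, rfl⟩)

/-- Only the linear term of the exponential survives one derivative at `t' = t`: higher powers keep
a factor `ξ`, which vanishes there. In `ξ` the time `t_k^{(i)}` multiplies `z ^ k`. -/
theorem mergeDeriv_expXi (p : Time) (i : Fin 3) (n : ℕ) :
    mergeDeriv p (expXi i n) = if i = p.1 ∧ n = (p.2 : ℕ) then 1 else 0 := by
  have h0 : mergeDeriv p (1 : TwoTimeSeries) = 0 := by
    rw [mergeDeriv, MvPowerSeries.pderiv_one, map_zero]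
  have hz : mergeDeriv p (0 : TwoTimeSeries) = 0 := by simp [mergeDeriv]
  have h1 : ∀ r, mergeDeriv p (PowerSeries.coeff n (xiDiff i ^ r)) =
      if r = 1 then mergeDeriv p (PowerSeries.coeff n (xiDiff i)) else 0 := by
    intro r
    rcases r with _ | _ | r
    · rw [pow_zero, PowerSeries.coeff_one]
      split_ifs <;> simp_all
    · simp
    · rw [pow_succ, PowerSeries.coeff_mul, mergeDeriv_sum, if_neg (by omega)]
      refine Finset.sum_eq_zero fun x _ => ?_
      rw [mergeDeriv_mul, merge_coeff_xiDiff, merge_coeff_xiDiff_pow_succ, mul_zero, zero_mul,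
        zero_add]
  rw [expXi, mergeDeriv_sum]
  simp only [mergeDeriv_smul, h1, smul_ite, smul_zero]
  rw [Finset.sum_ite_eq', mergeDeriv_coeff_xiDiff]
  by_cases h : i = p.1 ∧ n = (p.2 : ℕ)
  · have := p.2.pos
    rw [if_pos (by rw [Finset.mem_range]; omega), h.2]
    simp [h.1]
  · simp [h]

/-- `∑ expXi i n * F n`, coefficient by coefficient. -/
def expSum (i : Fin 3) (F : ℕ → TwoTimeSeries) : TwoTimeSeries :=
  fun d => ∑ᶠ n : ℕ, MvPowerSeries.coeff d (expXi i n * F n)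

theorem coeff_expSum (i : Fin 3) (F : ℕ → TwoTimeSeries) (M : ℕ) (d : Time ⊕ Time →₀ ℕ)
    (h : timeWeight d ≤ M) : MvPowerSeries.coeff d (expSum i F) =
      MvPowerSeries.coeff d (∑ n ∈ Finset.range (M + 1), expXi i n * F n) := by
  rw [map_sum]
  refine finsum_eq_sum_of_support_subset _ fun n hn => ?_
  rw [Finset.mem_coe, Finset.mem_range]
  by_contra h1
  refine hn ?_
  have := (weightGE_expXi i n).mul (k := 0) (G := F n) fun d hd => by omega
  exact this d (by omega)

/-- Only finitely many monomials in `t, t'` merge to a given monomial in `t`, so one weight bound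
`M` serves them all. The offset `u` is zero for restriction and a single variable for a derivative
followed by restriction. -/
theorem coeff_merge_congr (x : Time →₀ ℕ) (u : Time ⊕ Time →₀ ℕ) :
    ∃ M : ℕ, ∀ F G : TwoTimeSeries,
      (∀ d, timeWeight d ≤ M → MvPowerSeries.coeff d F = MvPowerSeries.coeff d G) →
      ∀ d, d.mapDomain (Sum.elim id id) = x →
        MvPowerSeries.coeff (d + u) F = MvPowerSeries.coeff (d + u) G := by
  classical
  let s := (Filter.TendstoCofinite.finite_preimage_singleton
    (Finsupp.mapDomain (M := ℕ) (Sum.elim id id : Time ⊕ Time → Time)) x).toFinset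
  refine ⟨s.sup fun d => timeWeight (d + u), fun F G h d hd => h _ ?_⟩
  exact Finset.le_sup (f := fun d => timeWeight (d + u)) (by simpa [s] using hd)

theorem merge_expSum (i : Fin 3) (F : ℕ → TwoTimeSeries) : merge (expSum i F) = merge (F 0) := by
  ext x
  obtain ⟨M, hM⟩ := coeff_merge_congr x 0
  have h := hM _ _ (coeff_expSum i F M)
  have h1 : merge (F 0) = merge (∑ n ∈ Finset.range (M + 1), expXi i n * F n) := by
    rw [map_sum, Finset.sum_range_succ', Finset.sum_eq_zero]
    · rw [zero_add, map_mul, merge_expXi, if_pos rfl, one_mul]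
    · intro n _
      rw [map_mul, merge_expXi, if_neg (by omega), zero_mul]
  rw [h1, merge, MvPowerSeries.coeff_rename, MvPowerSeries.coeff_rename]
  refine Finset.sum_congr rfl fun d hd => ?_
  simpa using h d (by simpa using hd)

theorem mergeDeriv_expSum (p : Time) (i : Fin 3) (F : ℕ → TwoTimeSeries) :
    mergeDeriv p (expSum i F) =
      mergeDeriv p (F 0) + if i = p.1 then merge (F p.2) else 0 := by
  ext x
  obtain ⟨M, hM⟩ := coeff_merge_congr x (Finsupp.single (Sum.inl p) 1)
  -- The truncation is taken at `M + k`, with `p = (_, k)`, so that the index `n = k` selected by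
  -- the derivative of the exponential is certainly included.
  have h := hM _ _ fun d hd => coeff_expSum i F (M + p.2) d (by omega)
  have h1 : mergeDeriv p (F 0) + (if i = p.1 then merge (F p.2) else 0) =
      mergeDeriv p (∑ n ∈ Finset.range (M + p.2 + 1), expXi i n * F n) := by
    rw [mergeDeriv_sum]
    simp only [mergeDeriv_mul, mergeDeriv_expXi, merge_expXi, ite_mul, one_mul, zero_mul,
      Finset.sum_add_distrib, Finset.sum_ite_eq', ite_and]
    rw [add_comm]
    have h2 : 0 ∈ Finset.range (M + p.2 + 1) := by simp
    rw [if_pos h2]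
    split_ifs with h1 <;> simp
  rw [h1, mergeDeriv, mergeDeriv, merge, MvPowerSeries.coeff_rename, MvPowerSeries.coeff_rename]
  refine Finset.sum_congr rfl fun d hd => ?_
  rw [MvPowerSeries.coeff_pderiv, MvPowerSeries.coeff_pderiv, h d (by simpa using hd)]

/-- The coefficient of `z ^ l` in the product of the series with coefficients `c` and `g`. -/
def diag (c g : ℕ → TimeSeries) (l : ℤ) : TimeSeries :=
  if 0 ≤ l then ∑ q ∈ Finset.HasAntidiagonal.antidiagonal l.toNat, c q.1 * g q.2 else 0

theorem merge_pairCoeff (i : Fin 3) (f g : TimeSeries) (l : ℤ) :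
    merge (pairCoeff i f g l) = diag (shiftCoeff i (-1) f) (shiftCoeff i 1 g) l := by
  unfold pairCoeff diag
  split_ifs
  · simp only [map_sum, map_mul, merge_rename_inl, merge_rename_inr]
  · exact map_zero _

theorem mergeDeriv_pairCoeff (p : Time) (i : Fin 3) (f g : TimeSeries) (l : ℤ) :
    mergeDeriv p (pairCoeff i f g l) =
      diag (fun n => MvPowerSeries.pderiv ℂ p (shiftCoeff i (-1) f n)) (shiftCoeff i 1 g) l := by
  unfold pairCoeff diag
  split_ifs
  · rw [mergeDeriv_sum]
    refine Finset.sum_congr rfl fun q _ => ?_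
    rw [mergeDeriv_mul, mergeDeriv, mergeDeriv, pderiv_inl_rename_inl, pderiv_inl_rename_inr,
      map_zero, mul_zero, add_zero, merge_rename_inl, merge_rename_inr]
  · simp [mergeDeriv]

theorem resInfty_eq_expSum (i : Fin 3) (a : ℤ) (f g : TimeSeries) :
    resInfty i a f g = expSum i fun n => pairCoeff i f g (n + a + 1) := rfl

theorem resZero_eq_expSum (i : Fin 3) (a : ℤ) (f g : TimeSeries) :
    resZero i a f g = expSum i fun n => pairCoeff i f g (n - a - 1) := rfl

/-- The bilinear equation at `t' = t`. -/
theorem IsThreeKPTau.diag_eq {τ : Site → TimeSeries} (h : IsThreeKPTau τ) (m m' : Site) :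
    diag (shiftCoeff 0 (-1) (τ m)) (shiftCoeff 0 1 (τ m')) (m.1 - m'.1 + 1) =
      diag (shiftCoeff 1 (-1) (τ (m + (1, 1)))) (shiftCoeff 1 1 (τ (m' - (1, 1))))
        (m'.2 - m.2 - 1) +
      (-1 : ℂ) ^ (m.2 + m'.2) •
        diag (shiftCoeff 2 (-1) (τ (m + (1, 0)))) (shiftCoeff 2 1 (τ (m' - (1, 0))))
          (m'.1 - m'.2 - (m.1 - m.2) - 1) := by
  have h1 := congrArg merge (h m m')
  rw [resInfty_eq_expSum, resZero_eq_expSum, resZero_eq_expSum, map_add, map_smul, merge_expSum,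
    merge_expSum, merge_expSum, merge_pairCoeff, merge_pairCoeff, merge_pairCoeff] at h1
  rw [show m'.2 - m.2 - 1 = ((0 : ℕ) : ℤ) - (m.2 - m'.2) - 1 by push_cast; ring,
    show m'.1 - m'.2 - (m.1 - m.2) - 1 = ((0 : ℕ) : ℤ) - (m.1 - m.2 - m'.1 + m'.2) - 1 by
      push_cast; ring, ← h1]
  simp

/-- The derivative of the bilinear equation with respect to a time `t`, at `t' = t`. -/
theorem IsThreeKPTau.diag_deriv_eq {τ : Site → TimeSeries} (h : IsThreeKPTau τ) (m m' : Site)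
    (p : Time) :
    diag (fun n => MvPowerSeries.pderiv ℂ p (shiftCoeff 0 (-1) (τ m) n))
        (shiftCoeff 0 1 (τ m')) (m.1 - m'.1 + 1) +
      (if 0 = p.1 then diag (shiftCoeff 0 (-1) (τ m)) (shiftCoeff 0 1 (τ m'))
        (m.1 - m'.1 + 1 + p.2) else 0) =
    diag (fun n => MvPowerSeries.pderiv ℂ p (shiftCoeff 1 (-1) (τ (m + (1, 1))) n))
        (shiftCoeff 1 1 (τ (m' - (1, 1)))) (m'.2 - m.2 - 1) +
      (if 1 = p.1 then diag (shiftCoeff 1 (-1) (τ (m + (1, 1))))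
        (shiftCoeff 1 1 (τ (m' - (1, 1)))) (m'.2 - m.2 - 1 + p.2) else 0) +
    (-1 : ℂ) ^ (m.2 + m'.2) •
      (diag (fun n => MvPowerSeries.pderiv ℂ p (shiftCoeff 2 (-1) (τ (m + (1, 0))) n))
        (shiftCoeff 2 1 (τ (m' - (1, 0)))) (m'.1 - m'.2 - (m.1 - m.2) - 1) +
      (if 2 = p.1 then diag (shiftCoeff 2 (-1) (τ (m + (1, 0))))
        (shiftCoeff 2 1 (τ (m' - (1, 0)))) (m'.1 - m'.2 - (m.1 - m.2) - 1 + p.2) else 0)) := by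
  have h1 := congrArg (mergeDeriv p) (h m m')
  have hadd : ∀ F G, mergeDeriv p (F + G) = mergeDeriv p F + mergeDeriv p G := fun F G => by
    simp only [mergeDeriv, map_add]
  rw [resInfty_eq_expSum, resZero_eq_expSum, resZero_eq_expSum, hadd, mergeDeriv_smul,
    mergeDeriv_expSum, mergeDeriv_expSum, mergeDeriv_expSum] at h1
  simp only [merge_pairCoeff, mergeDeriv_pairCoeff] at h1
  rw [show m'.2 - m.2 - 1 + p.2 = (p.2 : ℕ) - (m.2 - m'.2) - 1 by ring,
    show m'.1 - m'.2 - (m.1 - m.2) - 1 + p.2 = (p.2 : ℕ) - (m.1 - m.2 - m'.1 + m'.2) - 1 by ring,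
    show m'.2 - m.2 - 1 = ((0 : ℕ) : ℤ) - (m.2 - m'.2) - 1 by push_cast; ring,
    show m'.1 - m'.2 - (m.1 - m.2) - 1 = ((0 : ℕ) : ℤ) - (m.1 - m.2 - m'.1 + m'.2) - 1 by
      push_cast; ring, ← h1, add_assoc (m.1 - m'.1), add_comm (m.1 - m'.1),
    add_comm (1 : ℤ) (p.2 : ℕ), add_assoc, add_comm 1 (m.1 - m'.1), ← add_assoc,
    add_comm (m.1 - m'.1) (p.2 : ℤ)]
  simp

/-! ### The constant term in `z` of a shifted series -/

/-- A given monomial can occur in the image of at most two variables: once as the variable itself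
and once as a power of `z`. The substitution is thus a genuine one. -/
theorem hasSubst_shiftVar (i : Fin 3) (c : ℂ) : MvPowerSeries.HasSubst (shiftVar i c) := by
  classical
  refine ⟨fun p => ?_, fun d => ?_⟩
  · have : MvPowerSeries.constantCoeff (shiftVar i c p) = 0 := by
      unfold shiftVar
      split_ifs <;> simp
    rw [this]
    exact IsNilpotent.zero
  · have h1 : {p : Time | d = Finsupp.single (some p) 1}.Finite :=
      Set.Subsingleton.finite fun p hp q hq => by
        have := hp.symm.trans hq
        simpa [Finsupp.single_left_inj] using this
    have h2 : {p : Time | p.1 = i ∧ d = Finsupp.single none (p.2 : ℕ)}.Finite :=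
      Set.Subsingleton.finite fun p hp q hq => by
        have := hp.2.symm.trans hq.2
        exact Prod.ext (hp.1.trans hq.1.symm)
          (PNat.coe_inj.1 (by simpa [Finsupp.single_left_inj] using DFunLike.congr_fun this none))
    refine (h1.union h2).subset fun p hp => ?_
    by_contra hn
    rw [Set.mem_union, not_or] at hn
    refine hp ?_
    unfold shiftVar
    rw [map_add, MvPowerSeries.coeff_X, if_neg (by exact hn.1), zero_add]
    split_ifs with h
    · rw [MvPowerSeries.coeff_C_mul, MvPowerSeries.coeff_X_pow, if_neg fun h3 => hn.2 ⟨h, h3⟩,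
        mul_zero]
    · exact map_zero _

/-- Setting `z = 0`, realised by `killCompl`, turns the shift into the identity substitution.
Leading coefficients of wave functions are thereby expressed through unshifted tau functions. -/
theorem shiftCoeff_zero (i : Fin 3) (c : ℂ) (f : TimeSeries) : shiftCoeff i c f 0 = f := by
  classical
  let e : Time ↪ Option Time := Function.Embedding.some
  have hkill : ∀ p, MvPowerSeries.killCompl e (shiftVar i c p) = MvPowerSeries.X p := fun p => by
    unfold shiftVar
    have h1 := MvPowerSeries.killCompl_X (R := ℂ) (e := e) p
    have h2 := MvPowerSeries.killCompl_X_eq_zero (R := ℂ) (e := e) (t := none) (by simp [e])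
    rw [map_add, show MvPowerSeries.killCompl e (MvPowerSeries.X (some p)) =
      (MvPowerSeries.X p : TimeSeries) from h1]
    split_ifs
    · rw [map_mul, map_pow, h2, zero_pow p.2.ne_zero, mul_zero, add_zero]
    · rw [map_zero, add_zero]
  have hmon : ∀ a : Time →₀ ℕ, MvPowerSeries.killCompl e (a.prod fun p n => shiftVar i c p ^ n) =
      MvPowerSeries.monomial a 1 := fun a => by
    rw [Finsupp.prod, map_prod, MvPowerSeries.monomial_one_eq]
    exact Finset.prod_congr rfl fun p _ => by rw [map_pow, hkill]
  ext d
  have h1 : MvPowerSeries.coeff d (shiftCoeff i c f 0) =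
      MvPowerSeries.coeff (d.embDomain e) (MvPowerSeries.subst (shiftVar i c) f) := by
    rw [Finsupp.embDomain_eq_mapDomain]
    change MvPowerSeries.coeff (d.mapDomain some + Finsupp.single none 0) _ = _
    rw [Finsupp.single_zero, add_zero]
    rfl
  rw [h1, MvPowerSeries.coeff_subst (hasSubst_shiftVar i c), finsum_eq_single _ d]
  · rw [← MvPowerSeries.coeff_killCompl, hmon, MvPowerSeries.coeff_monomial_same, smul_eq_mul,
      mul_one]
  · intro a ha
    rw [← MvPowerSeries.coeff_killCompl, hmon, MvPowerSeries.coeff_monomial_ne ha.symm, smul_zero]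

end

end ThreeKP

namespace ThreeKP

open Op OpRing

noncomputable section

/-! ### Wave functions and the bilinear pairing with the dual wave functions -/

/-- The shift of the lattice in the `i`-th wave function. -/
def waveShift : Fin 3 → Site := ![0, (1, 1), (1, 0)]

/-- The order in the spectral parameter at which the `i`-th wave function starts; the first
component is expanded in `z⁻¹`, the other ones in `z`. -/
def waveOrd : Fin 3 → Site → ℤ := ![fun m => -m.1, fun m => m.2, fun m => m.1 - m.2]

/-- The sign in the `i`-th wave function. -/
def waveSign : Fin 3 → Site → TimeField := ![1, 1, fun m => (-1) ^ m.2]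

/-- The coefficients of the `i`-th wave operator. -/
def waveCoeff (τ : Site → TimeSeries) (i : Fin 3) (n : ℕ) (m : Site) : TimeField :=
  waveSign i m * tauQ (shiftCoeff i (-1) (τ (m + waveShift i)) n) / tauQ (τ m)

/-- The coefficients of the triple of wave functions at the site `m`. -/
def wave (τ : Site → TimeSeries) (m : Site) : Fin 3 → ℤ → TimeField :=
  fun i n => extZero (fun k => waveCoeff τ i k m) (n - waveOrd i m)

/-- The coefficients of the time derivative of the triple of wave functions. -/
def waveDeriv (τ : Site → TimeSeries) (p : Time) (m : Site) : Fin 3 → ℤ → TimeField :=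
  fun i n => timeDeriv p (wave τ m i n) + if i = p.1 then wave τ m i (n + p.2) else 0

/-- The coefficients of the dual wave functions. -/
def dualWave (τ : Site → TimeSeries) (i : Fin 3) (m : Site) (q : ℕ) : TimeField :=
  tauQ (shiftCoeff i 1 (τ (m - waveShift i)) q)

/-- The coefficient of order `l` of the product of two series. -/
def conv (w : ℤ → TimeField) (g : ℕ → TimeField) (l : ℤ) : TimeField := ∑ᶠ q : ℕ, w (l - q) * g q

theorem finite_support_conv {w : ℤ → TimeField} {N : ℤ} (hw : ∀ n < N, w n = 0)
    (g : ℕ → TimeField) (l : ℤ) : (Function.support fun q : ℕ => w (l - q) * g q).Finite := by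
  refine (Set.finite_le_nat (l - N).toNat).subset fun q hq => ?_
  have : ¬ l - q < N := fun h => left_ne_zero_of_mul hq (hw _ h)
  simp only [Set.mem_ofPred_eq]
  omega

theorem conv_add {w w' : ℤ → TimeField} {N N' : ℤ} (hw : ∀ n < N, w n = 0)
    (hw' : ∀ n < N', w' n = 0) (g : ℕ → TimeField) (l : ℤ) :
    conv (w + w') g l = conv w g l + conv w' g l := by
  rw [conv, conv, conv, ← finsum_add_distrib (finite_support_conv hw g l)
    (finite_support_conv hw' g l)]
  exact finsum_congr fun q => add_mul _ _ _

theorem conv_smul (x : TimeField) (w : ℤ → TimeField) (g : ℕ → TimeField) (l : ℤ) :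
    conv (x • w) g l = x * conv w g l := by
  rw [conv, conv, mul_finsum]
  exact finsum_congr fun q => mul_assoc _ _ _

/-- The second series starts at order zero, so the lowest coefficient of a product is the product of
the lowest coefficients. This is the diagonal of the triangular pairing. -/
theorem conv_of_forall_lt {w : ℤ → TimeField} {n : ℤ} (hw : ∀ k < n, w k = 0)
    (g : ℕ → TimeField) : conv w g n = w n * g 0 := by
  rw [conv, finsum_eq_single _ 0]
  · simp
  · intro q hq
    rw [hw _ (by omega), zero_mul]

theorem conv_eq_zero {w : ℤ → TimeField} {n : ℤ} (hw : ∀ k ≤ n, w k = 0)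
    (g : ℕ → TimeField) : conv w g n = 0 := by
  rw [conv_of_forall_lt (fun k hk => hw k hk.le), hw n le_rfl, zero_mul]

theorem conv_zero (g : ℕ → TimeField) (l : ℤ) : conv 0 g l = 0 :=
  conv_eq_zero (fun _ _ => rfl) g

theorem conv_extZero (c g : ℕ → TimeSeries) (s l : ℤ) :
    conv (fun n => extZero (fun k => tauQ (c k)) (n - s)) (fun q => tauQ (g q)) l =
      tauQ (diag c g (l - s)) := by
  unfold diag conv
  split_ifs with h
  · rw [Finset.Nat.sum_antidiagonal_eq_sum_range_succ_mk, ← Finset.sum_range_reflect,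
      finsum_eq_sum_of_support_subset (s := Finset.range ((l - s).toNat + 1))]
    · simp only [tauQ, map_sum, map_mul]
      refine Finset.sum_congr rfl fun q hq => ?_
      rw [Finset.mem_range] at hq
      rw [show l - q - s = (((l - s).toNat + 1 - 1 - q : ℕ) : ℤ) by omega, extZero_natCast,
        show (l - s).toNat - ((l - s).toNat + 1 - 1 - q) = q by omega]
    · intro q hq
      have h1 := left_ne_zero_of_mul hq
      have : ¬ l - q - s < 0 := fun h2 => h1 (extZero_of_neg _ h2)
      rw [Finset.mem_coe, Finset.mem_range]
      omega
  · rw [tauQ, map_zero]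
    refine (finsum_congr fun q => ?_).trans finsum_zero
    exact mul_eq_zero_of_left (extZero_of_neg _ (by omega)) _

/-- Triples satisfying, together with all the dual wave functions, the bilinear equation at
equal times. -/
def bilinear (τ : Site → TimeSeries) : Submodule TimeField (Fin 3 → ℤ → TimeField) where
  carrier := {W | (∃ N, ∀ i, ∀ n < N, W i n = 0) ∧ ∀ m : Site,
    conv (W 0) (dualWave τ 0 m) (1 - m.1) = conv (W 1) (dualWave τ 1 m) (m.2 - 1) +
      (-1) ^ m.2 * conv (W 2) (dualWave τ 2 m) (m.1 - m.2 - 1)}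
  zero_mem' := ⟨⟨0, fun _ _ _ => rfl⟩, fun m => by
    simp [conv_zero]⟩
  add_mem' := by
    rintro V W ⟨⟨N, hN⟩, hV⟩ ⟨⟨N', hN'⟩, hW⟩
    refine ⟨⟨min N N', fun i n hn => ?_⟩, fun m => ?_⟩
    · rw [Pi.add_apply, Pi.add_apply, hN i n (lt_of_lt_of_le hn (min_le_left _ _)),
        hN' i n (lt_of_lt_of_le hn (min_le_right _ _)), add_zero]
    · simp only [Pi.add_apply]
      rw [conv_add (hN 0) (hN' 0), conv_add (hN 1) (hN' 1), conv_add (hN 2) (hN' 2), hV, hW]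
      ring
  smul_mem' := by
    rintro x W ⟨⟨N, hN⟩, hW⟩
    refine ⟨⟨N, fun i n hn => ?_⟩, fun m => ?_⟩
    · rw [Pi.smul_apply, Pi.smul_apply, hN i n hn, smul_zero]
    · simp only [Pi.smul_apply]
      rw [conv_smul, conv_smul, conv_smul, hW]
      ring

theorem eq_zero_of_forall_lt {w : ℤ → TimeField} {s : ℤ} (hs : ∀ n < s, w n = 0)
    (h : ∀ n, s ≤ n → (∀ k < n, w k = 0) → w n = 0) : w = 0 := by
  have key : ∀ k : ℕ, ∀ n < s + k, w n = 0 := fun k => by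
    induction k with
    | zero => simpa using hs
    | succ k ih =>
      intro n hn
      rcases lt_or_ge n (s + k) with h1 | h1
      · exact ih n h1
      · exact h n (by omega) fun l hl => ih l (by push_cast at hn; omega)
  funext n
  exact key (n - s + 1).toNat n (by omega)

theorem dualWave_zero_ne_zero {τ : Site → TimeSeries} (hτ : ∀ m, τ m ≠ 0) (i : Fin 3) (m : Site) :
    dualWave τ i m 0 ≠ 0 := by
  rw [dualWave, shiftCoeff_zero]
  exact tauQ_ne_zero (hτ _)

/-- A solution of the bilinear equation of sufficiently high order vanishes. -/
theorem eq_zero_of_mem_bilinear {τ : Site → TimeSeries} (hτ : ∀ m, τ m ≠ 0)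
    {W : Fin 3 → ℤ → TimeField} (hW : W ∈ bilinear τ) (M : Site)
    (h0 : ∀ n < 1 - M.1, W 0 n = 0) (h1 : ∀ n < M.2, W 1 n = 0)
    (h2 : ∀ n < M.1 - M.2, W 2 n = 0) : W = 0 := by
  have hrel := hW.2
  have hW0 : W 0 = 0 := eq_zero_of_forall_lt h0 fun n hn hlt => by
    -- The dual site is chosen to test the coefficient of order `n` of the first series, while the
    -- other two are tested at orders below their starts.
    have h := hrel (1 - n, M.2)
    rw [conv_eq_zero (fun k hk => h1 k (by simp only at hk; omega)),
      conv_eq_zero (fun k hk => h2 k (by simp only at hk; omega)), mul_zero, add_zero,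
      show 1 - ((1 - n, M.2) : Site).1 = n by simp, conv_of_forall_lt hlt] at h
    exact (mul_eq_zero.1 h).resolve_right (dualWave_zero_ne_zero hτ _ _)
  have hW1 : W 1 = 0 := eq_zero_of_forall_lt h1 fun n hn hlt => by
    -- With the first series gone, this site tests order `n` of the second one and order `M.1 - M.2
    -- - 1` of the third, just below its start.
    have h := hrel (M.1 - M.2 + n + 1, n + 1)
    rw [hW0, conv_zero,
      conv_eq_zero (fun k hk => h2 k (by simp only at hk; omega)), mul_zero, add_zero,
      show ((M.1 - M.2 + n + 1, n + 1) : Site).2 - 1 = n by simp, conv_of_forall_lt hlt] at h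
    exact (mul_eq_zero.1 h.symm).resolve_right (dualWave_zero_ne_zero hτ _ _)
  have hW2 : W 2 = 0 := eq_zero_of_forall_lt h2 fun n hn hlt => by
    have h := hrel (n + 1, 0)
    rw [hW0, hW1, conv_zero, conv_zero, zero_add,
      show ((n + 1, 0) : Site).1 - ((n + 1, 0) : Site).2 - 1 = n by simp,
      conv_of_forall_lt hlt] at h
    have h3 := (mul_eq_zero.1 h.symm).resolve_left (zpow_ne_zero _ (neg_ne_zero.2 one_ne_zero))
    exact (mul_eq_zero.1 h3).resolve_right (dualWave_zero_ne_zero hτ _ _)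
  funext i
  fin_cases i
  · exact hW0
  · exact hW1
  · exact hW2

theorem waveOrd_add (i : Fin 3) (m u : Site) : waveOrd i (m + u) = waveOrd i m + waveOrd i u := by
  fin_cases i <;> simp [waveOrd] <;> ring

theorem waveOrd_zsmul (i : Fin 3) (c : ℤ) (u : Site) : waveOrd i (c • u) = c * waveOrd i u := by
  fin_cases i <;> simp [waveOrd] <;> ring

theorem wave_of_lt (τ : Site → TimeSeries) {m : Site} {i : Fin 3} {n : ℤ} (h : n < waveOrd i m) :
    wave τ m i n = 0 := extZero_of_neg _ (by omega)

theorem wave_waveOrd (τ : Site → TimeSeries) (m : Site) (i : Fin 3) :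
    wave τ m i (waveOrd i m) = waveSign i m * tauQ (τ (m + waveShift i)) / tauQ (τ m) := by
  rw [wave, sub_self, ← Nat.cast_zero, extZero_natCast, waveCoeff, shiftCoeff_zero]

theorem wave_zero_waveOrd {τ : Site → TimeSeries} (hτ : ∀ m, τ m ≠ 0) (m : Site) :
    wave τ m 0 (waveOrd 0 m) = 1 := by
  rw [wave_waveOrd]
  simp [waveSign, waveShift, tauQ_ne_zero (hτ m)]

theorem timeDeriv_waveSign_mul (p : Time) (i : Fin 3) (m : Site) (x : TimeField) :
    timeDeriv p (waveSign i m * x) = waveSign i m * timeDeriv p x := by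
  have h : waveSign i m = 1 ∨ waveSign i m = -1 := by
    fin_cases i
    · exact Or.inl rfl
    · exact Or.inl rfl
    · rcases Int.even_or_odd m.2 with h | h
      · exact Or.inl h.neg_one_zpow
      · exact Or.inr h.neg_one_zpow
  rcases h with h | h <;> simp [h, timeDeriv_neg]

theorem timeDeriv_tauQ_div (p : Time) (f : TimeSeries) {g : TimeSeries} (hg : g ≠ 0) :
    timeDeriv p (tauQ f / tauQ g) = tauQ (MvPowerSeries.pderiv ℂ p f) / tauQ g -
      tauQ (MvPowerSeries.pderiv ℂ p g) / tauQ g ^ 2 * tauQ f := by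
  have := tauQ_ne_zero hg
  rw [tauQ, tauQ, timeDeriv_div _ _ _ hg]
  unfold tauQ at *
  simp only [map_sub, map_mul]
  field_simp

theorem tauQ_neg_one_zpow_smul (n : ℤ) (f : TimeSeries) :
    tauQ ((-1 : ℂ) ^ n • f) = (-1) ^ n * tauQ f := by
  rcases Int.even_or_odd n with h | h <;> simp [h.neg_one_zpow, tauQ]

theorem waveOrd_bddBelow (τ : Site → TimeSeries) (m : Site) (k : ℤ) :
    ∃ N, ∀ i, ∀ n < N, wave τ m i (n + k) = 0 := by
  obtain ⟨N, hN⟩ := (Set.finite_range fun i => waveOrd i m).bddBelow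
  refine ⟨N - k, fun i n hn => wave_of_lt τ ?_⟩
  have := hN ⟨i, rfl⟩
  simp only at this
  omega

theorem conv_wave (τ : Site → TimeSeries) (m m' : Site) (i : Fin 3) (l : ℤ) :
    conv (wave τ m i) (dualWave τ i m') l = waveSign i m / tauQ (τ m) *
      tauQ (diag (shiftCoeff i (-1) (τ (m + waveShift i))) (shiftCoeff i 1 (τ (m' - waveShift i)))
        (l - waveOrd i m)) := by
  rw [← conv_extZero, ← conv_smul]
  refine congrArg₂ (fun w g => conv w g l) (funext fun n => ?_) rfl
  rw [Pi.smul_apply, smul_eq_mul, wave, extZero, extZero]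
  split_ifs
  · rw [waveCoeff, div_mul_eq_mul_div]
  · rw [mul_zero]

theorem conv_comp_add (w : ℤ → TimeField) (g : ℕ → TimeField) (k l : ℤ) :
    conv (fun n => w (n + k)) g l = conv w g (l + k) :=
  finsum_congr fun q => by simp only [sub_add_eq_add_sub]

/-- Differentiating the denominator `τ_m` gives a multiple of the wave function itself, with a
factor independent of `i` and `n`. That part already satisfies the bilinear equation, and only the
derivative of the numerator needs the differentiated equation. -/
theorem timeDeriv_wave {τ : Site → TimeSeries} (hτ : ∀ m, τ m ≠ 0) (p : Time) (m : Site)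
    (i : Fin 3) (n : ℤ) : timeDeriv p (wave τ m i n) =
      waveSign i m / tauQ (τ m) * extZero (fun k => tauQ (MvPowerSeries.pderiv ℂ p
        (shiftCoeff i (-1) (τ (m + waveShift i)) k))) (n - waveOrd i m) +
      -(tauQ (MvPowerSeries.pderiv ℂ p (τ m)) / tauQ (τ m)) * wave τ m i n := by
  have hT := tauQ_ne_zero (hτ m)
  rw [wave, extZero, extZero]
  split_ifs
  · rw [waveCoeff, mul_div_assoc, timeDeriv_waveSign_mul, timeDeriv_tauQ_div p _ (hτ m)]
    field_simp
    ring
  · rw [timeDeriv_zero, mul_zero, mul_zero, add_zero]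

theorem conv_waveDeriv {τ : Site → TimeSeries} (hτ : ∀ m, τ m ≠ 0) (p : Time) (m m' : Site)
    (i : Fin 3) (l : ℤ) :
    conv (waveDeriv τ p m i) (dualWave τ i m') l = waveSign i m / tauQ (τ m) *
      tauQ (diag (fun k => MvPowerSeries.pderiv ℂ p (shiftCoeff i (-1) (τ (m + waveShift i)) k))
        (shiftCoeff i 1 (τ (m' - waveShift i))) (l - waveOrd i m)) +
      -(tauQ (MvPowerSeries.pderiv ℂ p (τ m)) / tauQ (τ m)) *
        conv (wave τ m i) (dualWave τ i m') l +
      if i = p.1 then conv (wave τ m i) (dualWave τ i m') (l + p.2) else 0 := by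
  have hsplit : waveDeriv τ p m i = (waveSign i m / tauQ (τ m)) • (fun n =>
      extZero (fun k => tauQ (MvPowerSeries.pderiv ℂ p
        (shiftCoeff i (-1) (τ (m + waveShift i)) k))) (n - waveOrd i m)) +
      (-(tauQ (MvPowerSeries.pderiv ℂ p (τ m)) / tauQ (τ m))) • wave τ m i +
      (if i = p.1 then (1 : TimeField) else 0) • fun n => wave τ m i (n + p.2) := by
    funext n
    rw [waveDeriv, timeDeriv_wave hτ]
    split_ifs <;> simp
  obtain ⟨N, hN⟩ := waveOrd_bddBelow τ m p.2
  have h1 : ∀ n < waveOrd i m, extZero (fun k => tauQ (MvPowerSeries.pderiv ℂ p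
      (shiftCoeff i (-1) (τ (m + waveShift i)) k))) (n - waveOrd i m) = 0 := fun n hn =>
    extZero_of_neg _ (by omega)
  have h2 : ∀ n < waveOrd i m, wave τ m i n = 0 := fun n hn => wave_of_lt τ hn
  rw [hsplit, conv_add (N := waveOrd i m) (N' := N), conv_add (N := waveOrd i m)
    (N' := waveOrd i m), conv_smul, conv_smul, conv_smul, conv_comp_add,
    ite_mul, one_mul, zero_mul, ← conv_extZero]
  · rfl
  · intro n hn
    rw [Pi.smul_apply, h1 n hn, smul_zero]
  · intro n hn
    rw [Pi.smul_apply, h2 n hn, smul_zero]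
  · intro n hn
    rw [Pi.add_apply, Pi.smul_apply, Pi.smul_apply, h1 n hn, h2 n hn, smul_zero, smul_zero,
      add_zero]
  · intro n hn
    rw [Pi.smul_apply, hN i n hn, smul_zero]

theorem wave_mem_bilinear {τ : Site → TimeSeries} (hKP : IsThreeKPTau τ) (m : Site) :
    wave τ m ∈ bilinear τ := by
  refine ⟨by simpa using waveOrd_bddBelow τ m 0, fun m' => ?_⟩
  have h := congrArg tauQ (hKP.diag_eq m m')
  rw [show ∀ f g, tauQ (f + g) = tauQ f + tauQ g from fun f g => map_add _ f g,
    tauQ_neg_one_zpow_smul, zpow_add₀ (neg_ne_zero.2 one_ne_zero)] at h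
  rw [conv_wave, conv_wave, conv_wave]
  simp only [waveShift, waveOrd, waveSign, Matrix.cons_val, Pi.one_apply, add_zero, sub_zero]
  rw [show 1 - m'.1 - -m.1 = m.1 - m'.1 + 1 by ring, show m'.2 - 1 - m.2 = m'.2 - m.2 - 1 by ring,
    show m'.1 - m'.2 - 1 - (m.1 - m.2) = m'.1 - m'.2 - (m.1 - m.2) - 1 by ring, h]
  ring

theorem waveDeriv_mem_bilinear {τ : Site → TimeSeries} (hτ : ∀ m, τ m ≠ 0)
    (hKP : IsThreeKPTau τ) (p : Time) (m : Site) : waveDeriv τ p m ∈ bilinear τ := by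
  constructor
  · obtain ⟨N, hN⟩ := waveOrd_bddBelow τ m p.2
    obtain ⟨N', hN'⟩ := waveOrd_bddBelow τ m 0
    refine ⟨min N N', fun i n hn => ?_⟩
    have h1 := hN i n (lt_of_lt_of_le hn (min_le_left _ _))
    have h2 := hN' i n (lt_of_lt_of_le hn (min_le_right _ _))
    rw [add_zero] at h2
    rw [waveDeriv, h1, h2, timeDeriv_zero, ite_self, add_zero]
  · intro m'
    have h0 := (wave_mem_bilinear hKP m).2 m'
    have h := congrArg tauQ (hKP.diag_deriv_eq m m' p)
    simp only [show ∀ f g, tauQ (f + g) = tauQ f + tauQ g from fun f g => map_add _ f g,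
      tauQ_neg_one_zpow_smul, zpow_add₀ (neg_ne_zero.2 (one_ne_zero (α := TimeField))),
      apply_ite tauQ, show tauQ 0 = 0 from map_zero _] at h
    rw [conv_waveDeriv hτ, conv_waveDeriv hτ, conv_waveDeriv hτ, h0]
    simp only [conv_wave]
    simp only [waveShift, waveOrd, waveSign, Matrix.cons_val, Pi.one_apply, add_zero, sub_zero]
    rw [show 1 - m'.1 - -m.1 = m.1 - m'.1 + 1 by ring,
      show m'.2 - 1 - m.2 = m'.2 - m.2 - 1 by ring,
      show m'.1 - m'.2 - 1 - (m.1 - m.2) = m'.1 - m'.2 - (m.1 - m.2) - 1 by ring,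
      show 1 - m'.1 + p.2 - -m.1 = m.1 - m'.1 + 1 + p.2 by ring,
      show m'.2 - 1 + p.2 - m.2 = m'.2 - m.2 - 1 + p.2 by ring,
      show m'.1 - m'.2 - 1 + p.2 - (m.1 - m.2) = m'.1 - m'.2 - (m.1 - m.2) - 1 + p.2 by ring]
    simp only [← mul_ite_zero]
    linear_combination (1 / tauQ (τ m)) * h

/-- The linear equation `H Ψ = 0`. -/
theorem wave_linear {τ : Site → TimeSeries} (hτ : ∀ m, τ m ≠ 0) (hKP : IsThreeKPTau τ)
    (m : Site) : wave τ (m + (1, 1)) - wave τ (m + (1, 0)) + rho τ m • wave τ m = 0 := by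
  refine eq_zero_of_mem_bilinear hτ (add_mem (sub_mem (wave_mem_bilinear hKP _)
    (wave_mem_bilinear hKP _)) (Submodule.smul_mem _ _ (wave_mem_bilinear hKP _)))
    (m + (1, 0)) ?_ ?_ ?_
  -- In the first series both shifted wave functions start at the same order with coefficient `1`,
  -- and their difference gains one order.
  · intro n hn
    simp only [Pi.add_apply, Pi.sub_apply, Pi.smul_apply]
    simp only [Prod.fst_add] at hn
    rw [wave_of_lt (m := m) (i := 0) τ (by simp [waveOrd]; omega), smul_zero, add_zero]
    rcases lt_or_eq_of_le (show n ≤ -m.1 - 1 by omega) with h | h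
    · rw [wave_of_lt τ (by simp [waveOrd]; omega), wave_of_lt τ (by simp [waveOrd]; omega), sub_zero]
    · have h1 := wave_zero_waveOrd hτ (m + (1, 1))
      have h2 := wave_zero_waveOrd hτ (m + (1, 0))
      rw [show waveOrd 0 (m + (1, 1)) = n by simp [waveOrd]; omega] at h1
      rw [show waveOrd 0 (m + (1, 0)) = n by simp [waveOrd]; omega] at h2
      rw [h1, h2, sub_self]
  · intro n hn
    simp only [Pi.add_apply, Pi.sub_apply, Pi.smul_apply]
    simp only [Prod.snd_add] at hn
    rw [wave_of_lt τ (by simp [waveOrd]; omega), wave_of_lt τ (by simp [waveOrd]; omega),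
      wave_of_lt τ (by simp [waveOrd]; omega)]
    simp
  -- In the third series the terms at `m + e` and `m` start at the same order, one below the
  -- required bound; `ρ` and the sign `(-1) ^ m₂` are such that their leading coefficients cancel.
  · intro n hn
    simp only [Pi.add_apply, Pi.sub_apply, Pi.smul_apply]
    simp only [Prod.snd_add, Prod.fst_add] at hn
    rw [wave_of_lt (m := m + (1, 0)) τ (by simp [waveOrd]; omega), sub_zero]
    rcases lt_or_eq_of_le (show n ≤ m.1 - m.2 by omega) with h | h
    · rw [wave_of_lt τ (by simp [waveOrd]; omega), wave_of_lt τ (by simp [waveOrd]; omega)]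
      simp
    · have h1 := wave_waveOrd τ (m + (1, 1)) 2
      have h2 := wave_waveOrd τ m 2
      rw [show waveOrd 2 (m + (1, 1)) = n by simp [waveOrd]; omega] at h1
      rw [show waveOrd 2 m = n by simp [waveOrd]; omega] at h2
      rw [h1, h2, smul_eq_mul, rho]
      have t1 := tauQ_ne_zero (hτ m)
      have t2 := tauQ_ne_zero (hτ (m + (1, 0)))
      have t3 := tauQ_ne_zero (hτ (m + (1, 1)))
      simp only [waveShift, waveSign, Matrix.cons_val, Prod.snd_add]
      rw [zpow_add₀ (neg_ne_zero.2 one_ne_zero)]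
      field_simp
      ring

/-- The linear evolution equation of the wave operator `S`, for an operator `B` which makes it hold
up to terms of high order. -/
theorem deriv_wave_operator {τ : Site → TimeSeries} (hτ : ∀ m, τ m ≠ 0) (hKP : IsThreeKPTau τ)
    {v : Site} [IsUnitStep v] (i : Fin 3) (k : ℕ+) (hv : waveOrd i v = 1)
    (hv' : ∀ i', i' ≠ i → waveOrd i' v ≤ 0) {N : ℕ} {B : OpRing v} (hB : Within v (-N) 0 B.1)
    (hB' : ∀ j m, B.1 j m ≠ 0 → along v j ≤ 0)
    (hB0 : i ≠ 0 → ∀ m, ∑ c ∈ Finset.Icc (-N : ℤ) 0,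
      B.1 (c • v) m * wave τ (m + c • v) 0 (waveOrd 0 m) = 0)
    (hU : Within v (if i = 0 then 1 else 0) 0 (deriv (i, k) (ser v (waveCoeff τ i)) +
      ser v (waveCoeff τ i) * sh v (-((k : ℕ) • v)) - B * ser v (waveCoeff τ i)).1) :
    deriv (i, k) (ser v (waveCoeff τ i)) =
      B * ser v (waveCoeff τ i) - ser v (waveCoeff τ i) * sh v (-((k : ℕ) • v)) := by
  rw [eq_sub_iff_add_eq, ← sub_eq_zero]
  set S := ser v (waveCoeff τ i) with hS
  set U := deriv (i, k) S + S * sh v (-((k : ℕ) • v)) - B * S with hUdef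
  have hSapp : ∀ n m, S.1 (n • v) m = wave τ m i (n + waveOrd i m) := fun n m => by
    rw [hS, val_ser, series_apply, across_zsmul, if_pos rfl, along_zsmul, wave,
      add_sub_cancel_right]
  have hmem : ∀ m, waveDeriv τ (i, k) m - ∑ c ∈ Finset.Icc (-N : ℤ) 0,
      B.1 (c • v) m • wave τ (m + c • v) ∈ bilinear τ := fun m =>
    sub_mem (waveDeriv_mem_bilinear hτ hKP _ _) (sum_mem fun c _ =>
      Submodule.smul_mem _ _ (wave_mem_bilinear hKP _))
  -- Since `waveOrd i v = 1`, right multiplication by `Q` acts as the spectral parameter, so the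
  -- operator defect `U` is the `i`-th component of a triple in `bilinear`.
  have hUapp : ∀ n m, U.1 (n • v) m = (waveDeriv τ (i, k) m - ∑ c ∈ Finset.Icc (-N : ℤ) 0,
      B.1 (c • v) m • wave τ (m + c • v)) i (n + waveOrd i m) := fun n m => by
    rw [Pi.sub_apply, Pi.sub_apply, waveDeriv, if_pos rfl, hUdef, val_sub, Op.sub_apply, val_add,
      Op.add_apply, val_deriv, tderiv, hSapp, val_mul, val_sh, mul_shift_apply, val_mul,
      mul_apply_zsmul hB S.1 n m (s := Finset.Icc (-N : ℤ) 0)]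
    · congr 1
      · congr 1
        rw [sub_neg_eq_add, ← natCast_zsmul, ← add_smul, hSapp]
        congr 1
        ring
      · rw [Finset.sum_apply, Finset.sum_apply]
        refine Finset.sum_congr rfl fun c _ => ?_
        rw [hSapp, waveOrd_add, waveOrd_zsmul, hv, Pi.smul_apply, Pi.smul_apply, smul_eq_mul]
        congr 2
        ring
    · intro c h1 _
      have h2 := (hB _ _ h1).1
      have h3 := hB' _ _ h1
      rw [along_zsmul] at h2 h3
      rw [Finset.mem_Icc]
      omega
  have hW : ∀ m, waveDeriv τ (i, k) m - ∑ c ∈ Finset.Icc (-N : ℤ) 0,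
      B.1 (c • v) m • wave τ (m + c • v) = 0 := fun m => by
    have key : ∀ i' : Fin 3, ∀ n < waveOrd i' m + (if i' = 0 then 1 else 0),
        (waveDeriv τ (i, k) m - ∑ c ∈ Finset.Icc (-N : ℤ) 0,
          B.1 (c • v) m • wave τ (m + c • v)) i' n = 0 := by
      intro i' n hn
      by_cases hi : i' = i
      · subst hi
        have h := hUapp (n - waveOrd i' m) m
        rw [sub_add_cancel] at h
        rw [← h]
        by_contra h1
        have h2 := (hU _ _ h1).1
        rw [along_zsmul] at h2
        omega
      · rw [Pi.sub_apply, Pi.sub_apply, waveDeriv, if_neg hi, add_zero, Finset.sum_apply,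
          Finset.sum_apply]
        simp only [Pi.smul_apply, smul_eq_mul]
        rcases lt_or_ge n (waveOrd i' m) with h | h
        · rw [wave_of_lt τ h, timeDeriv_zero, zero_sub, neg_eq_zero]
          -- Along the other components, a shift by `c • v` with `c ≤ 0` cannot lower the starting
          -- order, as `waveOrd i' v ≤ 0`.
          refine Finset.sum_eq_zero fun c hc => ?_
          rw [wave_of_lt, mul_zero]
          rw [waveOrd_add, waveOrd_zsmul]
          rw [Finset.mem_Icc] at hc
          have := mul_nonneg_of_nonpos_of_nonpos hc.2 (hv' i' hi)
          omega
        -- One coefficient remains: the leading one of the first series. It is the constant `1`, so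
        -- its derivative vanishes, and `hB0` removes the contribution of `B`.
        · split_ifs at hn with h0
          · subst h0
            obtain rfl : n = waveOrd 0 m := by omega
            rw [wave_zero_waveOrd hτ, timeDeriv_one, hB0 (Ne.symm hi), sub_zero]
          · omega
    refine eq_zero_of_mem_bilinear hτ (hmem m) m ?_ ?_ ?_
    · intro n hn
      exact key 0 n (by simp [waveOrd]; omega)
    · intro n hn
      exact key 1 n (by simp [waveOrd]; omega)
    · intro n hn
      exact key 2 n (by simp [waveOrd]; omega)
  refine OpRing.ext (Op.ext fun j m => ?_)
  by_cases hj : across v j = 0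
  · rw [eq_zsmul_of_across_eq_zero v hj, hUapp, hW]
    rfl
  · by_contra h
    exact hj (by have := hU _ _ h; omega)

end

end ThreeKP

namespace ThreeKP

open Op OpRing

noncomputable section

/-! ### Lax operators in the rings of operators -/

section Lax

variable (τ : Site → TimeSeries) (v : Site) [IsUnitStep v] (i : Fin 3)

/-- The `i`-th wave operator with `Q = Λ ^ v` as the spectral parameter. -/
def waveOp : OpRing v := ser v (waveCoeff τ i)

/-- The `i`-th Lax operator. -/
def laxOp : OpRing v := waveOp τ v i * sh v (-v) * inverse 0 (waveOp τ v i)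

/-- The operator `H`. -/
def hOp : OpRing v := sh v (1, 0) * (sh v (0, 1) - 1) + mulFn v (rho τ)

theorem val_hOp : (hOp τ v).1 = H τ := by
  rw [hOp, val_add, val_mul, val_sub]
  rfl

theorem hOp_eq : hOp τ v = sh v (1, 1) - sh v (1, 0) + mulFn v (rho τ) := by
  rw [hOp, mul_sub, mul_one, sh_mul_sh]
  rfl

variable {τ v i}

theorem waveOp_apply (j m : Site) : (waveOp τ v i).1 j m =
    if across v j = 0 then wave τ m i (along v j + waveOrd i m) else 0 := by
  rw [waveOp, val_ser, series_apply, wave, add_sub_cancel_right]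

theorem within_waveOp : Within v 0 0 (waveOp τ v i).1 := within_series v _

theorem waveOp_zero_ne_zero (hτ : ∀ m, τ m ≠ 0) (m : Site) :
    (waveOp τ v i).1 ((0 : ℤ) • v) m ≠ 0 := by
  rw [waveOp_apply, across_zsmul, if_pos rfl, along_zsmul, zero_add, wave_waveOrd]
  refine div_ne_zero (mul_ne_zero ?_ (tauQ_ne_zero (hτ _))) (tauQ_ne_zero (hτ _))
  fin_cases i
  · exact one_ne_zero
  · exact one_ne_zero
  · exact zpow_ne_zero _ (neg_ne_zero.2 one_ne_zero)

theorem waveOp_mul_inverse (hτ : ∀ m, τ m ≠ 0) :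
    waveOp τ v i * inverse 0 (waveOp τ v i) = 1 :=
  mul_inverse within_waveOp (waveOp_zero_ne_zero hτ)

theorem inverse_mul_waveOp (hτ : ∀ m, τ m ≠ 0) :
    inverse 0 (waveOp τ v i) * waveOp τ v i = 1 :=
  inverse_mul within_waveOp (waveOp_zero_ne_zero hτ)

/-- Moving the wave function to `m + u` changes its starting order by `waveOrd i u`. The right
factor `Λ ^ w` replaces the lattice shift left over from `Λ ^ u` by the matching power of `Q`. -/
theorem sh_mul_waveOp_mul_sh_apply {u w : Site} (h : across v (u + w) = 0)
    (h' : along v (u + w) = waveOrd i u) (j m : Site) :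
    (sh v u * waveOp τ v i * sh v w).1 j m =
      if across v j = 0 then wave τ (m + u) i (along v j + waveOrd i m) else 0 := by
  rw [across_add] at h
  rw [along_add] at h'
  rw [val_mul, val_sh, mul_shift_apply, val_mul, val_sh, shift_mul_apply, waveOp_apply,
    across_sub, across_sub, along_sub, along_sub, waveOrd_add]
  congr 1
  · rw [eq_iff_iff]
    constructor <;> intro <;> omega
  · congr 1
    omega

/-- The equation `H Ψ = 0` as an equation between operators. -/
theorem waveOp_linear (hτ : ∀ m, τ m ≠ 0) (hKP : IsThreeKPTau τ) {w w' : Site}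
    (h₁ : across v ((1, 1) + w) = 0) (h₂ : along v ((1, 1) + w) = waveOrd i (1, 1))
    (h₃ : across v ((1, 0) + w') = 0) (h₄ : along v ((1, 0) + w') = waveOrd i (1, 0)) :
    sh v (1, 1) * waveOp τ v i * sh v w - sh v (1, 0) * waveOp τ v i * sh v w' +
      mulFn v (rho τ) * waveOp τ v i = 0 := OpRing.ext (Op.ext fun j m => by
  have h := congrFun (congrFun (wave_linear hτ hKP m) i) (along v j + waveOrd i m)
  simp only [Pi.add_apply, Pi.sub_apply, Pi.smul_apply, smul_eq_mul, Pi.zero_apply] at h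
  rw [val_add, Op.add_apply, val_sub, Op.sub_apply, sh_mul_waveOp_mul_sh_apply h₁ h₂,
    sh_mul_waveOp_mul_sh_apply h₃ h₄, val_mul, val_mulFn, fn_mul_apply, waveOp_apply]
  split_ifs
  · exact h
  · rw [sub_zero, mul_zero, add_zero]
    rfl)

theorem laxOp_pow (hτ : ∀ m, τ m ≠ 0) (k : ℕ) :
    laxOp τ v i ^ k = waveOp τ v i * sh v (-(k • v)) * inverse 0 (waveOp τ v i) := by
  induction k with
  | zero => simp [sh_zero, waveOp_mul_inverse hτ]
  | succ k ih =>
    rw [pow_succ, ih, laxOp]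
    simp only [mul_assoc]
    rw [← mul_assoc (inverse 0 _) (waveOp τ v i), inverse_mul_waveOp hτ, one_mul,
      ← mul_assoc (sh v _), sh_mul_sh, succ_nsmul, neg_add]

theorem within_inverse_waveOp : Within v 0 0 (inverse 0 (waveOp τ v i)).1 := by
  have : Within v (along v (-((0 : ℤ) • v)) + 0) 0 (inverse 0 (waveOp τ v i)).1 :=
    (within_shift v (-((0 : ℤ) • v)) (by simp)).mul_zero_across
      (within_series v (invCoeff v fun n => (waveOp τ v i).1 ((0 + n : ℤ) • v)))
  rwa [zero_smul, neg_zero, along_zero, add_zero] at this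

theorem within_laxOp_pow (hτ : ∀ m, τ m ≠ 0) (k : ℕ) : Within v (-k) 0 (laxOp τ v i ^ k).1 := by
  have h : along v (-(k • v)) = -k := by rw [← natCast_zsmul, ← neg_smul, along_zsmul]
  have h' : across v (-(k • v)) = 0 := by rw [← natCast_zsmul, ← neg_smul, across_zsmul]
  rw [laxOp_pow hτ]
  have := ((within_waveOp (τ := τ) (v := v) (i := i)).mul_zero_across (within_shift v _ h')).mul_zero_across
    (within_inverse_waveOp (τ := τ) (v := v) (i := i))
  rwa [h, zero_add, add_zero] at this

/-- The first wave operator has constant leading coefficient `1`, so its derivative gains an order.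
This is why the projection keeps order zero for `i = 0` and drops it otherwise. -/
theorem within_deriv_waveOp (hτ : ∀ m, τ m ≠ 0) (p : Time) :
    Within v (if i = 0 then 1 else 0) 0 (deriv p (waveOp τ v i)).1 := by
  intro j m h
  have h1 := within_waveOp.tderiv p j m h
  split_ifs with hi
  · subst hi
    refine ⟨?_, h1.2⟩
    by_contra h2
    refine h ?_
    rw [val_deriv, tderiv, waveOp_apply, show along v j = 0 by omega, zero_add,
      wave_zero_waveOrd hτ]
    split_ifs
    · exact timeDeriv_one p
    · exact timeDeriv_zero p
  · exact h1

/-- The evolution of `T` when `H = ± (K Λ ^ u - T)` and `K` is `1` or `1 - Q`. -/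
theorem deriv_eq_of_waveOp (hτ : ∀ m, τ m ≠ 0) (hKP : IsThreeKPTau τ) (k : ℕ+)
    (hv : waveOrd i v = 1) (hv' : ∀ i', i' ≠ i → waveOrd i' v ≤ 0) {K K' T : OpRing v} {u w : Site}
    (hK : Within v 0 0 K.1) (hK' : Within v 0 0 K'.1) (hKK' : K' * K = 1)
    (hKu : sh v u * K = K * sh v u) (hdK : ∀ p, deriv p K = 0)
    (hrel : K * sh v u * waveOp τ v i * sh v w = T * waveOp τ v i) {G : OpRing v}
    (hG : G = part (fun j => j < if i = 0 then 1 else 0) (laxOp τ v i ^ (k : ℕ) * K'))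
    (hB' : ∀ j m, (G * K).1 j m ≠ 0 → along v j ≤ 0)
    (hB0 : i ≠ 0 → ∀ m, ∑ c ∈ Finset.Icc (-((k : ℕ) : ℤ)) 0,
      (G * K).1 (c • v) m * wave τ (m + c • v) 0 (waveOrd 0 m) = 0) :
    deriv (i, k) T = K * sh v u * G * sh v (-u) * T - T * (G * K) ∧
      K * sh v u * G * sh v (-u) * (K * sh v u) = K * sh v u * (G * K) := by
  have hC : K * sh v u * G * sh v (-u) * (K * sh v u) = K * sh v u * (G * K) := by
    rw [← hKu, ← mul_assoc _ (sh v u) K, mul_assoc _ (sh v (-u)), sh_neg_mul, mul_one, mul_assoc]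
  have hLK : Within v (-(k : ℕ)) 0 (laxOp τ v i ^ (k : ℕ) * K').1 := by
    have := (within_laxOp_pow (v := v) (i := i) hτ k).mul_zero_across hK'
    rwa [add_zero] at this
  have hGw : Within v (-(k : ℕ)) 0 G.1 := by
    rw [hG]
    exact hLK.partAlong fun j => j < if i = 0 then 1 else 0
  have hB : Within v (-(k : ℕ)) 0 (G * K).1 := by
    have := hGw.mul_zero_across hK
    rwa [add_zero] at this
  refine ⟨?_, hC⟩
  refine deriv_eq_of_dressing (i, k) hrel (deriv_wave_operator hτ hKP i k hv hv' hB hB' hB0 ?_)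
    (sh_commute _ _) hC ?_ (deriv_sh _ _) (waveOp_mul_inverse hτ)
  · change Within v _ 0 (deriv (i, k) (waveOp τ v i) + waveOp τ v i * sh v (-((k : ℕ) • v)) -
      G * K * waveOp τ v i).1
    -- `S Q ^ (-k) = L ^ k S = (L ^ k K⁻¹) K S`, so after subtracting `G K S` only the complement of
    -- the projection is left.
    have h1 : waveOp τ v i * sh v (-((k : ℕ) • v)) =
        laxOp τ v i ^ (k : ℕ) * K' * K * waveOp τ v i := by
      rw [mul_assoc _ K', hKK', mul_one, laxOp_pow hτ, mul_assoc _ (inverse 0 _),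
        inverse_mul_waveOp hτ, mul_one]
    rw [h1, add_sub_assoc, ← sub_mul, ← sub_mul]
    refine (within_deriv_waveOp hτ _).add ?_
    have h2 : Within v (if i = 0 then 1 else 0) 0 (laxOp τ v i ^ (k : ℕ) * K' - G).1 := by
      intro j m h
      rw [hG, val_sub, Op.sub_apply, val_part, partAlong] at h
      refine ⟨?_, (hLK j m ?_).2⟩
      · by_contra h3
        rw [if_pos (by omega), sub_self] at h
        exact h rfl
      · intro h3
        rw [h3, ite_self, sub_self] at h
        exact h rfl
    have := (h2.mul_zero_across hK).mul_zero_across (within_waveOp (τ := τ) (v := v) (i := i))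
    rwa [add_zero, add_zero] at this
  · rw [OpRing.deriv_mul, hdK, deriv_sh, zero_mul, mul_zero, add_zero]

theorem sum_Icc_neg_eq (f : ℤ → TimeField) (N : ℕ) :
    ∑ c ∈ Finset.Icc (-N : ℤ) 0, f c = ∑ n ∈ Finset.range (N + 1), f (-n) := by
  refine Finset.sum_nbij' (fun c => (-c).toNat) (fun n => -n) ?_ ?_ ?_ ?_ ?_
  · intro c hc
    rw [Finset.mem_Icc] at hc
    rw [Finset.mem_range]
    omega
  · intro n hn
    rw [Finset.mem_range] at hn
    rw [Finset.mem_Icc]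
    omega
  · intro c hc
    rw [Finset.mem_Icc] at hc
    omega
  · intro n _
    omega
  · intro c hc
    rw [Finset.mem_Icc] at hc
    congr 1
    omega

/-- The case of the wave functions for which `K = 1 - Q`. -/
theorem deriv_eq_of_waveOp_oneSub (hτ : ∀ m, τ m ≠ 0) (hKP : IsThreeKPTau τ) (k : ℕ+)
    (hv : waveOrd i v = 1) (hv' : ∀ i', i' ≠ i → waveOrd i' v ≤ 0) (hv0 : waveOrd 0 v = 0)
    (hi : i ≠ 0) {T : OpRing v} {u w : Site}
    (hrel : oneSub v * sh v u * waveOp τ v i * sh v w = T * waveOp τ v i) {G : OpRing v}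
    (hG : G = part (fun j => j < 0) (laxOp τ v i ^ (k : ℕ) * oneSubInv v)) :
    deriv (i, k) T = oneSub v * sh v u * G * sh v (-u) * T - T * (G * oneSub v) ∧
      oneSub v * sh v u * G * sh v (-u) * (oneSub v * sh v u) =
        oneSub v * sh v u * (G * oneSub v) := by
  have hGneg : ∀ j m, ¬ along v j < 0 → G.1 j m = 0 := fun j m h => by
    rw [hG, val_part, partAlong, if_neg h]
  refine deriv_eq_of_waveOp hτ hKP k hv hv' within_oneSub (within_series v _) oneSubInv_mul
    (sh_mul_oneSub u) deriv_oneSub hrel ?_ ?_ ?_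
  · rw [hG]
    simp only [if_neg hi]
  · intro j m h
    by_contra h1
    refine h ?_
    rw [mul_oneSub_apply, hGneg _ _ (by omega), hGneg _ _ (by rw [along_sub, along_self]; omega),
      sub_zero]
  -- As `waveOrd 0 v = 0`, shifting along `v` keeps the leading coefficient `1` of the first series
  -- in place. The condition is that the coefficients of `G (1 - Q)` sum to zero, and they
  -- telescope.
  · intro _ m
    have h1 : ∀ c : ℤ, wave τ (m + c • v) 0 (waveOrd 0 m) = 1 := fun c => by
      have h2 := wave_zero_waveOrd hτ (m + c • v)
      rwa [waveOrd_add, waveOrd_zsmul, hv0, mul_zero, add_zero] at h2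
    have hGw : Within v (-(k : ℕ)) 0 G.1 := by
      rw [hG]
      refine Within.partAlong ?_ fun j => j < 0
      have := (within_laxOp_pow (v := v) (i := i) hτ k).mul_zero_across
        (within_series v fun _ _ => 1)
      rwa [add_zero] at this
    simp only [h1, mul_one]
    rw [sum_Icc_neg_eq (fun c => (G * oneSub v).1 (c • v) m)]
    have h3 : ∀ n : ℕ, (G * oneSub v).1 ((-n : ℤ) • v) m =
        G.1 ((-n : ℤ) • v) m - G.1 ((-((n + 1 : ℕ) : ℤ)) • v) m := fun n => by
      rw [mul_oneSub_apply]
      congr 2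
      push_cast
      module
    simp only [h3]
    rw [Finset.sum_range_sub' fun n : ℕ => G.1 ((-n : ℤ) • v) m, hGneg _ _ (by simp)]
    have h4 : G.1 ((-((k + 1 : ℕ) : ℤ)) • v) m = 0 := by
      by_contra h5
      have := (hGw _ _ h5).1
      rw [along_zsmul] at this
      push_cast at this
      omega
    rw [h4, sub_zero]

/-- Conjugation by `T` may be replaced by conjugation by `(1 - Q) Λ ^ u`. The prefactor `(1 - Q)⁻¹`
then cancels `1 - Q` on the left, and what is projected is `L ^ k (1 - Q)⁻¹` conjugated by a shift.
-/
theorem part_sub_part_conj (hτ : ∀ m, τ m ≠ 0) {T T' : OpRing v} {u w : Site}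
    (hrel : oneSub v * sh v u * waveOp τ v i * sh v w = T * waveOp τ v i) (hT : T' * T = 1)
    (k : ℕ) :
    part (fun j => j ≤ 0) (T * laxOp τ v i ^ k * T') -
        part (fun j => j = 0) (oneSubInv v * (T * laxOp τ v i ^ k * T')) =
      oneSub v * sh v u * part (fun j => j < 0) (laxOp τ v i ^ k * oneSubInv v) * sh v (-u) := by
  rw [part_nonpos_sub, laxOp, conj_lax_eq (F' := sh v (-u) * oneSubInv v) (Y' := sh v (-w)) hrel
    (sh_commute _ _) (sh_mul_neg w) _ (inverse_mul_waveOp hτ) (waveOp_mul_inverse hτ) hT,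
    ← laxOp]
  · have h : oneSubInv v * (oneSub v * sh v u * laxOp τ v i ^ k * (sh v (-u) * oneSubInv v)) =
        sh v u * (laxOp τ v i ^ k * oneSubInv v) * sh v (-u) := by
      rw [sh_mul_oneSubInv]
      simp only [← mul_assoc]
      rw [oneSubInv_mul, one_mul]
    rw [h, part_sh_conj]
    simp only [mul_assoc]
  · rw [mul_assoc, ← mul_assoc (sh v u), sh_mul_neg, one_mul, oneSub_mul_inv]

/-- The positive part in `Q⁻¹ - 1`, given by the coefficients of the powers of `Q⁻¹ - 1`. -/
theorem finsum_coeff_mul_pow (A : OpRing v) (N : ℕ) (hA : Within v (-N) 0 A.1) {c : ℕ → Op}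
    (hc : ∀ q, c q = (∑ n ∈ Finset.range (N + 1), n.choose q • mulFn v (A.1 ((-n : ℤ) • v))).1)
    {D : Op} (hD : D = (sh v (-v) - 1).1) :
    ∑ᶠ q : ℕ, (if 1 ≤ q then c q * D ^ q else 0) =
      (part (fun j => j < 0) (A * oneSubInv v) * oneSub v).1 := by
  have hterm : ∀ q, c q * D ^ q = ((∑ n ∈ Finset.range (N + 1),
      n.choose q • mulFn v (A.1 ((-n : ℤ) • v))) * (sh v (-v) - 1) ^ q).1 := fun q => by
    rw [val_mul, val_pow, hc, hD]
  rw [finsum_eq_sum_of_support_subset (s := Finset.range (N + 1)), Finset.sum_range_succ',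
    if_neg (by omega), add_zero, ← sum_choose_mul_pow A N hA, val_sum]
  · refine Finset.sum_congr rfl fun q _ => ?_
    rw [if_pos (by omega), hterm]
  · intro q hq
    rw [Finset.mem_coe, Finset.mem_range]
    by_contra h
    refine hq ?_
    change (if 1 ≤ q then c q * D ^ q else 0) = 0
    rw [if_pos (by omega), hterm, Finset.sum_eq_zero, zero_mul]
    · rfl
    · intro n hn
      rw [Finset.mem_range] at hn
      rw [Nat.choose_eq_zero_of_lt (by omega), zero_smul]

theorem zsmul_timeField (n : ℤ) (x : TimeField) : n • x = (n : TimeField) * x := by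
  rw [zsmul_eq_mul]

/-- Reindexing by `n = q + s` and using the symmetry of binomial coefficients; for `q ≥ 0` the
integer binomials are ordinary ones. -/
theorem finsum_choose_smul (f : ℕ → TimeField) (N : ℕ) (hf : ∀ n, N < n → f n = 0) (q : ℕ) :
    ∑ᶠ s : ℕ, Ring.choose ((q : ℤ) + s) s • f (q + s) =
      ∑ n ∈ Finset.range (N + 1), (n.choose q : TimeField) * f n := by
  have h1 : ∑ n ∈ Finset.range (N + 1), (n.choose q : TimeField) * f n =
      ∑ n ∈ Finset.range (q + (N + 1)), (n.choose q : TimeField) * f n := by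
    refine Finset.sum_subset (Finset.range_mono (by omega)) fun n _ hn => ?_
    rw [Finset.mem_range] at hn
    rw [hf n (by omega), mul_zero]
  simp only [zsmul_timeField]
  rw [h1, Finset.sum_range_add, Finset.sum_eq_zero, zero_add,
    finsum_eq_sum_of_support_subset (s := Finset.range (N + 1))]
  · refine Finset.sum_congr rfl fun s _ => ?_
    rw [← Nat.cast_add, Ring.choose_natCast, Int.cast_natCast, Nat.choose_symm_add]
  · intro s hs
    rw [Finset.mem_coe, Finset.mem_range]
    by_contra h
    refine right_ne_zero_of_mul hs ?_
    exact hf _ (by omega)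
  · intro n hn
    rw [Finset.mem_range] at hn
    rw [Nat.choose_eq_zero_of_lt hn, Nat.cast_zero, zero_mul]

theorem sum_choose_smul_mulFn_apply (A : OpRing v) (N q : ℕ) (j m : Site) :
    (∑ n ∈ Finset.range (N + 1), n.choose q • mulFn v (A.1 ((-n : ℤ) • v))).1 j m =
      if j = 0 then ∑ n ∈ Finset.range (N + 1), (n.choose q : TimeField) * A.1 ((-n : ℤ) • v) m
      else 0 := by
  have h : ∀ n : ℕ, (n.choose q • mulFn v (A.1 ((-n : ℤ) • v))).1 j m =
      if j = 0 then (n.choose q : TimeField) * A.1 ((-n : ℤ) • v) m else 0 := fun n => by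
    have h1 := map_nsmul ((coeffHom j m).comp (valHom v)) (n.choose q)
      (mulFn v (A.1 ((-n : ℤ) • v)))
    refine (h1.trans (nsmul_eq_mul _ _)).trans ?_
    change (n.choose q : TimeField) * (if j = 0 then _ else (0 : TimeField)) = _
    rw [mul_ite, mul_zero]
  rw [val_sum_apply]
  simp only [h]
  split_ifs
  · rfl
  · exact Finset.sum_const_zero

end Lax

end

end ThreeKP

/-! ### Identification with the operators of the statement, and the four evolution equations. -/

namespace ThreeKP

open Op OpRing

noncomputable section

/-- Here `Q = Λ₂` and `Δ₂^* = Q⁻¹ - 1`. Positive powers of `Q` expand into negative powers of `Δ₂^*`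
only, so just the finitely many nonpositive powers of `Q` in `A` matter. -/
theorem Δ₂starPart_eq (A : OpRing (0, 1)) (N : ℕ) (hA : Within (0, 1) (-N) 0 A.1) :
    Δ₂starPart A.1 =
      (part (fun j => j < 0) (A * oneSubInv (0, 1)) * oneSub (0, 1)).1 := by
  refine finsum_coeff_mul_pow A N hA (c := fun q => Δ₂starCoeff A.1 q) (fun q => ?_) ?_
  · refine Op.ext fun j m => ?_
    rw [sum_choose_smul_mulFn_apply, Δ₂starCoeff]
    obtain ⟨a, b⟩ := j
    by_cases hb : b = 0
    · rw [if_pos hb]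
      by_cases ha : a = 0
      · subst ha hb
        rw [if_pos (show ((0, 0) : Site) = 0 from rfl)]
        have h := finsum_choose_smul (fun n => A.1 ((-n : ℤ) • ((0, 1) : Site)) m) N (fun n hn => by
          by_contra h
          have := (hA _ _ h).1
          rw [along_zsmul] at this
          omega) q
        rw [← h]
        refine finsum_congr fun s => ?_
        congr 2
        simp
      · rw [if_neg (by simp [ha])]
        refine (finsum_congr fun s => ?_).trans finsum_zero
        have : A.1 (a, -((q : ℤ) + s)) m = 0 := by
          by_contra h
          have := (hA _ _ h).2
          simp only [across] at this
          omega
        rw [this, zsmul_timeField, mul_zero]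
    · rw [if_neg hb, if_neg (by simp [hb])]
  · rw [val_sub]
    rfl

theorem Δ₂part_eq (A : OpRing (0, -1)) (N : ℕ) (hA : Within (0, -1) (-N) 0 A.1) :
    Δ₂part A.1 =
      (part (fun j => j < 0) (A * oneSubInv (0, -1)) * oneSub (0, -1)).1 := by
  refine finsum_coeff_mul_pow A N hA (c := fun q => Δ₂coeff A.1 q) (fun q => ?_) ?_
  · refine Op.ext fun j m => ?_
    rw [sum_choose_smul_mulFn_apply, Δ₂coeff]
    obtain ⟨a, b⟩ := j
    by_cases hb : b = 0
    · rw [if_pos hb]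
      by_cases ha : a = 0
      · subst ha hb
        rw [if_pos (show ((0, 0) : Site) = 0 from rfl)]
        have h := finsum_choose_smul (fun n => A.1 ((-n : ℤ) • ((0, -1) : Site)) m) N
          (fun n hn => by
            by_contra h
            have := (hA _ _ h).1
            rw [along_zsmul] at this
            omega) q
        rw [← h]
        refine finsum_congr fun s => ?_
        congr 2
        simp
      · rw [if_neg (by simp [ha])]
        refine (finsum_congr fun s => ?_).trans finsum_zero
        have : A.1 (a, (q : ℤ) + s) m = 0 := by
          by_contra h
          have := (hA _ _ h).2
          simp only [across] at this
          omega
        rw [this, zsmul_timeField, mul_zero]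
    · rw [if_neg hb, if_neg (by simp [hb])]
  · rw [val_sub]
    rfl

/-- The extra `Λ₂^{∓1}` beside the inverse difference in `C^{(2)}` and `C^{(3)}(Λ₂)` lowers a
geometric series starting at `Q` to one starting at `1`. -/
theorem ser_one_le_mul_sh (v : Site) [IsUnitStep v] :
    ser v (fun n _ => if 1 ≤ n then 1 else 0) * sh v (-v) = oneSubInv v :=
  OpRing.ext (Op.ext fun j m => by
    rw [val_mul, val_sh, mul_shift_apply, sub_neg_eq_add, val_ser, series_apply, oneSubInv, val_ser,
      series_apply, across_add, across_self, add_zero, along_add, along_self]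
    simp only [extZero]
    split_ifs <;> first | rfl | omega)

theorem val_Δ₂starInv_mul_Λ₂inv : (oneSubInv (0, 1)).1 = Δ₂starInv * Λ₂inv := by
  rw [← ser_one_le_mul_sh]
  rfl

theorem val_Δ₂Inv_mul_Λ₂ : (oneSubInv (0, -1)).1 = Δ₂Inv * Λ₂ := by
  rw [← ser_one_le_mul_sh]
  rfl

variable {τ : Site → TimeSeries}

theorem rho_ne_zero (hτ : ∀ m, τ m ≠ 0) (m : Site) : rho τ m ≠ 0 :=
  mul_ne_zero (div_ne_zero (tauQ_ne_zero (hτ _)) (tauQ_ne_zero (hτ _)))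
    (div_ne_zero (tauQ_ne_zero (hτ _)) (tauQ_ne_zero (hτ _)))

theorem S₁_eq : S₁ τ = (waveOp τ (-1, 0) 0).1 := by
  rw [waveOp, val_ser, S₁]
  congr 1
  funext n m
  simp [waveCoeff, waveSign, waveShift]

theorem S₂_eq : S₂ τ = (waveOp τ (0, 1) 1).1 := by
  rw [waveOp, val_ser, S₂]
  congr 1
  funext n m
  simp [waveCoeff, waveSign, waveShift]

theorem waveCoeff₃_eq : waveCoeff₃ τ = waveCoeff τ 2 := by
  funext n m
  simp [waveCoeff₃, waveCoeff, waveSign, waveShift]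

theorem S₃_eq : S₃ τ = (waveOp τ (1, 0) 2).1 := by
  rw [waveOp, val_ser, S₃, waveCoeff₃_eq]

theorem S₃'_eq : S₃' τ = (waveOp τ (0, -1) 2).1 := by
  rw [waveOp, val_ser, S₃', waveCoeff₃_eq]

theorem L₁_pow_eq (k : ℕ) : L₁ τ ^ k = (laxOp τ (-1, 0) 0 ^ k).1 := by
  rw [val_pow, L₁, S₁_eq]
  rfl

theorem L₂_pow_eq (k : ℕ) : L₂ τ ^ k = (laxOp τ (0, 1) 1 ^ k).1 := by
  rw [val_pow, L₂, S₂_eq]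
  rfl

theorem L₃_pow_eq (k : ℕ) : L₃ τ ^ k = (laxOp τ (1, 0) 2 ^ k).1 := by
  rw [val_pow, L₃, S₃_eq]
  rfl

theorem L₃'_pow_eq (k : ℕ) : L₃' τ ^ k = (laxOp τ (0, -1) 2 ^ k).1 := by
  rw [val_pow, L₃', S₃'_eq]
  rfl

/-- `Λ₁ - ρ`. -/
def shSubRho (τ : Site → TimeSeries) (v : Site) [IsUnitStep v] : OpRing v :=
  sh v (1, 0) - mulFn v (rho τ)

theorem val_shSubRho (v : Site) [IsUnitStep v] : (shSubRho τ v).1 = Λ₁subRho τ := by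
  rw [shSubRho, val_sub]
  rfl

theorem hOp_eq_sub (v : Site) [IsUnitStep v] : hOp τ v = sh v (1, 1) - shSubRho τ v := by
  rw [hOp_eq, shSubRho]
  abel

theorem shSubRho_apply (v : Site) [IsUnitStep v] (j m : Site) :
    (shSubRho τ v).1 j m = (if j = (1, 0) then 1 else 0) - if j = 0 then rho τ m else 0 := by
  rw [shSubRho, val_sub]
  rfl

/-- `T` and the constant operator `F` satisfy the same linear evolution law, hence so does their
difference up to sign. -/
theorem deriv_hOp_eq {v : Site} [IsUnitStep v] {p : Time} {T F B C : OpRing v} {σ : ℤˣ}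
    (hH : hOp τ v = (σ : ℤ) • (T - F)) (hF : deriv p F = 0) (hT : deriv p T = C * T - T * B)
    (hC : C * F = F * B) : deriv p (hOp τ v) = C * hOp τ v - hOp τ v * B := by
  have h : ∀ A : OpRing v, deriv p ((σ : ℤ) • A) = (σ : ℤ) • deriv p A := fun A =>
    map_zsmul (derivHom v p) _ A
  rw [hH, h, OpRing.deriv_sub, hF, hT, mul_smul_comm, smul_mul_assoc, ← smul_sub, mul_sub, sub_mul, hC]
  congr 1
  abel

/-- The case `Q = Λ₁⁻¹`, with `H = F - T`, `F = Λ₁Λ₂`, `T = Λ₁ - ρ`. The leading coefficient of `T`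
is `1`, at order `-1` in `Q`. -/
theorem tderiv_zero_H (hτ : ∀ m, τ m ≠ 0) (hKP : IsThreeKPTau τ) (k : ℕ+) :
    tderiv (0, k) (H τ) = C₁ τ k * H τ - H τ * B₁ τ k := by
  set T := shSubRho τ (-1, 0) with hT
  have hTw : Within (-1, 0) (-1) 0 T.1 := fun j m h => by
    rw [hT, shSubRho_apply] at h
    split_ifs at h with h1 h2 h2
    · rw [h1]; simp [along, across]
    · rw [h1]; simp [along, across]
    · rw [h2]; simp
    · simp at h
  have hT0 : ∀ m, T.1 ((-1 : ℤ) • ((-1, 0) : Site)) m ≠ 0 := fun m => by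
    rw [hT, shSubRho_apply]
    simp
  have hrel : 1 * sh (-1, 0) (1, 1) * waveOp τ (-1, 0) 0 * sh (-1, 0) (0, -1) =
      T * waveOp τ (-1, 0) 0 := by
    have h := waveOp_linear (v := (-1, 0)) (i := 0) hτ hKP (w := (0, -1)) (w' := 0) (by decide)
      (by decide) (by decide) (by decide)
    rw [sh_zero, mul_one, sub_add, sub_eq_zero, ← sub_mul] at h
    rw [one_mul, h, hT, shSubRho]
  have hG : part (fun j => 0 ≥ j) (laxOp τ (-1, 0) 0 ^ (k : ℕ)) =
      part (fun j => j < if (0 : Fin 3) = 0 then 1 else 0) (laxOp τ (-1, 0) 0 ^ (k : ℕ) * 1) :=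
    OpRing.ext (Op.ext fun j m => by
      rw [val_part, val_part, mul_one, partAlong, partAlong]
      refine if_congr ?_ rfl rfl
      simp only [if_true]
      omega)
  obtain ⟨h1, h2⟩ := deriv_eq_of_waveOp hτ hKP k (by decide) (by decide) (within_one _)
    (within_one _) (one_mul 1) (by rw [mul_one, one_mul]) (fun p => deriv_one p) hrel hG
    (fun j m h => by
      rw [mul_one, val_part, partAlong] at h
      by_contra h3
      rw [if_neg (by omega)] at h
      exact h rfl)
    (fun h => (h rfl).elim)
  have hB : B₁ τ k = (part (fun j => 0 ≥ j) (laxOp τ (-1, 0) 0 ^ (k : ℕ)) * 1).1 := by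
    rw [mul_one, B₁, L₁_pow_eq]
    refine Op.ext fun j m => ?_
    rw [val_part, part₁, partAlong]
    refine if_congr ?_ rfl rfl
    simp [along]
  have hC : C₁ τ k = (1 * sh (-1, 0) (1, 1) * part (fun j => 0 ≥ j) (laxOp τ (-1, 0) 0 ^ (k : ℕ)) *
      sh (-1, 0) (-(1, 1))).1 := by
    rw [one_mul, ← part_sh_conj]
    have h3 := conj_lax_eq (F' := sh (-1, 0) (-(1, 1))) (Y' := sh (-1, 0) (-(0, -1)))
      (T' := inverse (-1) T) (E := sh (-1, 0) (-(-1, 0))) hrel (sh_commute _ _) (sh_mul_neg _)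
      (by rw [one_mul, sh_mul_neg]) (inverse_mul_waveOp hτ) (waveOp_mul_inverse hτ)
      (inverse_mul hTw hT0) k
    rw [one_mul] at h3
    change T * laxOp τ (-1, 0) 0 ^ (k : ℕ) * _ = _ * laxOp τ (-1, 0) 0 ^ (k : ℕ) * _ at h3
    rw [← h3, C₁, L₁_pow_eq, ← val_shSubRho (-1, 0), ← hT, ← val_mul, ← val_inverse, ← val_mul]
    refine Op.ext fun j m => ?_
    rw [val_part, part₁, partAlong]
    refine if_congr ?_ rfl rfl
    simp [along]
  rw [hB, hC, ← val_hOp τ (-1, 0), ← val_mul, ← val_mul, ← val_sub]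
  refine congrArg OpRing.val (deriv_hOp_eq (T := T) (F := 1 * sh (-1, 0) (1, 1)) (σ := -1)
    ?_ ?_ h1 h2)
  · rw [hOp_eq_sub, one_mul]
    simp [hT]
  · rw [one_mul, deriv_sh]

/-- The same splitting of `H` with `Q = Λ₁`; now the leading coefficient of `T` is `-ρ`, at order
zero. -/
theorem tderiv_two_H (hτ : ∀ m, τ m ≠ 0) (hKP : IsThreeKPTau τ) (k : ℕ+) :
    tderiv (2, k) (H τ) = C₃ τ k * H τ - H τ * B₃ τ k := by
  set T := shSubRho τ (1, 0) with hT
  have hTw : Within (1, 0) 0 0 T.1 := fun j m h => by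
    rw [hT, shSubRho_apply] at h
    split_ifs at h with h1 h2 h2
    · rw [h1]; simp [along, across]
    · rw [h1]; simp [along, across]
    · rw [h2]; simp
    · simp at h
  have hT0 : ∀ m, T.1 ((0 : ℤ) • ((1, 0) : Site)) m ≠ 0 := fun m => by
    rw [hT, shSubRho_apply, zero_smul, if_neg (by decide), if_pos rfl, zero_sub]
    exact neg_ne_zero.2 (rho_ne_zero hτ m)
  have hrel : 1 * sh (1, 0) (1, 1) * waveOp τ (1, 0) 2 * sh (1, 0) (-1, -1) =
      T * waveOp τ (1, 0) 2 := by
    have h := waveOp_linear (v := (1, 0)) (i := 2) hτ hKP (w := (-1, -1)) (w' := 0) (by decide)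
      (by decide) (by decide) (by decide)
    rw [sh_zero, mul_one, sub_add, sub_eq_zero, ← sub_mul] at h
    rw [one_mul, h, hT, shSubRho]
  have hG : part (fun j => j < 0) (laxOp τ (1, 0) 2 ^ (k : ℕ)) =
      part (fun j => j < if (2 : Fin 3) = 0 then 1 else 0) (laxOp τ (1, 0) 2 ^ (k : ℕ) * 1) := by
    rw [mul_one]
    rfl
  have hneg : ∀ j m, (part (fun j => j < 0) (laxOp τ (1, 0) 2 ^ (k : ℕ)) * 1).1 j m ≠ 0 →
      along (1, 0) j < 0 := fun j m h => by
    rw [mul_one, val_part, partAlong] at h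
    by_contra h3
    rw [if_neg (by omega)] at h
    exact h rfl
  obtain ⟨h1, h2⟩ := deriv_eq_of_waveOp hτ hKP k (by decide) (by decide) (within_one _)
    (within_one _) (one_mul 1) (by rw [mul_one, one_mul]) (fun p => deriv_one p) hrel hG
    (fun j m h => (hneg j m h).le)
    -- `B` has strictly negative orders in `Λ₁`, and each such shift makes the first series start
    -- later, so no term reaches its leading order at `m`.
    (fun _ m => Finset.sum_eq_zero fun c _ => by
      by_contra h
      have h3 := hneg _ _ (left_ne_zero_of_mul h)
      rw [along_zsmul] at h3
      refine right_ne_zero_of_mul h (wave_of_lt τ ?_)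
      rw [waveOrd_add, waveOrd_zsmul, show waveOrd 0 (1, 0) = -1 from rfl]
      omega)
  have hB : B₃ τ k = (part (fun j => j < 0) (laxOp τ (1, 0) 2 ^ (k : ℕ)) * 1).1 := by
    rw [mul_one, B₃, L₃_pow_eq]
    refine Op.ext fun j m => ?_
    rw [val_part, part₁, partAlong]
    refine if_congr ?_ rfl rfl
    simp [along]
  have hC : C₃ τ k = (1 * sh (1, 0) (1, 1) * part (fun j => j < 0) (laxOp τ (1, 0) 2 ^ (k : ℕ)) *
      sh (1, 0) (-(1, 1))).1 := by
    rw [one_mul, ← part_sh_conj]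
    have h3 := conj_lax_eq (F' := sh (1, 0) (-(1, 1))) (Y' := sh (1, 0) (-(-1, -1)))
      (T' := inverse 0 T) (E := sh (1, 0) (-(1, 0))) hrel (sh_commute _ _) (sh_mul_neg _)
      (by rw [one_mul, sh_mul_neg]) (inverse_mul_waveOp hτ) (waveOp_mul_inverse hτ)
      (inverse_mul hTw hT0) k
    rw [one_mul] at h3
    change T * laxOp τ (1, 0) 2 ^ (k : ℕ) * _ = _ * laxOp τ (1, 0) 2 ^ (k : ℕ) * _ at h3
    rw [← h3, C₃, L₃_pow_eq, ← val_shSubRho (1, 0), ← hT, ← val_mul, ← val_inverse, ← val_mul]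
    refine Op.ext fun j m => ?_
    rw [val_part, part₁, partAlong]
    refine if_congr ?_ rfl rfl
    simp [along]
  rw [hB, hC, ← val_hOp τ (1, 0), ← val_mul, ← val_mul, ← val_sub]
  refine congrArg OpRing.val (deriv_hOp_eq (T := T) (F := 1 * sh (1, 0) (1, 1)) (σ := -1)
    ?_ ?_ h1 h2)
  · rw [hOp_eq_sub, one_mul]
    simp [hT]
  · rw [one_mul, deriv_sh]

theorem mulFn_inv_mul {v : Site} [IsUnitStep v] (hτ : ∀ m, τ m ≠ 0) :
    mulFn v (rho τ)⁻¹ * mulFn v (rho τ) = 1 := by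
  rw [mulFn_mul_mulFn, ← mulFn_one]
  congr 1
  funext m
  exact inv_mul_cancel₀ (rho_ne_zero hτ m)

/-- The case `Q = Λ₂`, with `H = T - F`, `F = (1 - Λ₂) Λ₁`, `T = ρ`. Both shifted terms of the
linear equation need the same right factor, which lets `1 - Q` come out on the left. -/
theorem tderiv_one_H (hτ : ∀ m, τ m ≠ 0) (hKP : IsThreeKPTau τ) (k : ℕ+) :
    tderiv (1, k) (H τ) = C₂ τ k * H τ - H τ * B₂ τ k := by
  set T := mulFn (0, 1) (rho τ) with hT
  have hΘ : oneSub (0, 1) * sh (0, 1) (1, 0) = sh (0, 1) (1, 0) - sh (0, 1) (1, 1) := by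
    rw [oneSub, sub_mul, one_mul, sh_mul_sh]
    rfl
  have hrel : oneSub (0, 1) * sh (0, 1) (1, 0) * waveOp τ (0, 1) 1 * sh (0, 1) (-1, 0) =
      T * waveOp τ (0, 1) 1 := by
    have h := waveOp_linear (v := (0, 1)) (i := 1) hτ hKP (w := (-1, 0)) (w' := (-1, 0))
      (by decide) (by decide) (by decide) (by decide)
    rw [hΘ, sub_mul, sub_mul, ← sub_eq_zero, ← neg_eq_zero, ← h]
    abel
  obtain ⟨h1, h2⟩ := deriv_eq_of_waveOp_oneSub hτ hKP k (by decide) (by decide) (by decide)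
    (by decide) hrel rfl
  have hB : B₂ τ k = _ := (congrArg Δ₂starPart (L₂_pow_eq k)).trans
    (Δ₂starPart_eq _ k (within_laxOp_pow hτ k))
  have hC : C₂ τ k = (oneSub (0, 1) * sh (0, 1) (1, 0) *
      part (fun j => j < 0) (laxOp τ (0, 1) 1 ^ (k : ℕ) * oneSubInv (0, 1)) *
      sh (0, 1) (-(1, 0))).1 := by
    refine Eq.trans ?_ (congrArg OpRing.val
      (part_sub_part_conj hτ hrel (mulFn_inv_mul (v := (0, 1)) hτ) k))
    rw [val_sub, C₂, L₂_pow_eq, ← val_Δ₂starInv_mul_Λ₂inv]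
    congr 1
    · refine Op.ext fun j m => ?_
      rw [val_part, part₂, partAlong]
      refine if_congr ?_ rfl rfl
      simp [along]
    · rw [← mul_assoc, ← mul_assoc]
      refine Op.ext fun j m => ?_
      rw [val_part, part₂, partAlong]
      refine if_congr ?_ rfl rfl
      simp [along]
  rw [hB, hC, ← val_hOp τ (0, 1), ← val_mul, ← val_mul, ← val_sub]
  refine congrArg OpRing.val (deriv_hOp_eq (T := T)
    (F := oneSub (0, 1) * sh (0, 1) (1, 0)) (σ := 1) ?_ ?_ h1 h2)
  · rw [hOp_eq, hΘ, Units.val_one, one_smul, hT]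
    abel
  · rw [OpRing.deriv_mul, deriv_oneSub, deriv_sh, zero_mul, mul_zero, add_zero]

/-- The case `Q = Λ₂⁻¹`, with `H = F - T`, `F = (1 - Λ₂⁻¹) Λ₁Λ₂`, `T = -ρ`; the sign of `T` drops
out of the conjugation. -/
theorem tderiv_two_H' (hτ : ∀ m, τ m ≠ 0) (hKP : IsThreeKPTau τ) (k : ℕ+) :
    tderiv (2, k) (H τ) = C₃' τ k * H τ - H τ * B₃' τ k := by
  set T := -mulFn (0, -1) (rho τ) with hT
  have hΘ : oneSub (0, -1) * sh (0, -1) (1, 1) = sh (0, -1) (1, 1) - sh (0, -1) (1, 0) := by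
    rw [oneSub, sub_mul, one_mul, sh_mul_sh]
    rfl
  have hrel : oneSub (0, -1) * sh (0, -1) (1, 1) * waveOp τ (0, -1) 2 * sh (0, -1) (-1, -1) =
      T * waveOp τ (0, -1) 2 := by
    have h := waveOp_linear (v := (0, -1)) (i := 2) hτ hKP (w := (-1, -1)) (w' := (-1, -1))
      (by decide) (by decide) (by decide) (by decide)
    rw [hΘ, sub_mul, sub_mul, ← sub_eq_zero, hT, neg_mul, sub_neg_eq_add, h]
  obtain ⟨h1, h2⟩ := deriv_eq_of_waveOp_oneSub hτ hKP k (by decide) (by decide) (by decide)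
    (by decide) hrel rfl
  have hB : B₃' τ k = _ := (congrArg Δ₂part (L₃'_pow_eq k)).trans
    (Δ₂part_eq _ k (within_laxOp_pow hτ k))
  have hC : C₃' τ k = (oneSub (0, -1) * sh (0, -1) (1, 1) *
      part (fun j => j < 0) (laxOp τ (0, -1) 2 ^ (k : ℕ) * oneSubInv (0, -1)) *
      sh (0, -1) (-(1, 1))).1 := by
    refine Eq.trans ?_ (congrArg OpRing.val (part_sub_part_conj hτ hrel
      (T' := -mulFn (0, -1) (rho τ)⁻¹) (by rw [hT, neg_mul_neg, mulFn_inv_mul hτ]) k))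
    rw [val_sub, C₃', L₃'_pow_eq, ← val_Δ₂Inv_mul_Λ₂, hT, neg_mul, neg_mul_neg]
    congr 1
    · refine Op.ext fun j m => ?_
      rw [val_part, part₂, partAlong]
      refine if_congr ?_ rfl rfl
      simp [along]
    · rw [← mul_assoc, ← mul_assoc]
      refine Op.ext fun j m => ?_
      rw [val_part, part₂, partAlong]
      refine if_congr ?_ rfl rfl
      simp [along]
  rw [hB, hC, ← val_hOp τ (0, -1), ← val_mul, ← val_mul, ← val_sub]
  refine congrArg OpRing.val (deriv_hOp_eq (T := T)
    (F := oneSub (0, -1) * sh (0, -1) (1, 1)) (σ := -1) ?_ ?_ h1 h2)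
  · rw [hOp_eq, hΘ, hT]
    simp only [Units.val_neg, Units.val_one, neg_smul, one_smul]
    abel
  · rw [OpRing.deriv_mul, deriv_oneSub, deriv_sh, zero_mul, mul_zero, add_zero]

end

end ThreeKP

theorem mainTheorem9 (τ : ℤ × ℤ → ThreeKP.TimeSeries) (hτ : ∀ m, τ m ≠ 0)
    (hKP : ThreeKP.IsThreeKPTau τ) (k : ℕ+) :
    ThreeKP.Op.tderiv (0, k) (ThreeKP.H τ) =
        ThreeKP.C₁ τ k * ThreeKP.H τ - ThreeKP.H τ * ThreeKP.B₁ τ k ∧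
      ThreeKP.Op.tderiv (1, k) (ThreeKP.H τ) =
        ThreeKP.C₂ τ k * ThreeKP.H τ - ThreeKP.H τ * ThreeKP.B₂ τ k ∧
      ThreeKP.Op.tderiv (2, k) (ThreeKP.H τ) =
        ThreeKP.C₃ τ k * ThreeKP.H τ - ThreeKP.H τ * ThreeKP.B₃ τ k ∧
      ThreeKP.Op.tderiv (2, k) (ThreeKP.H τ) =
        ThreeKP.C₃' τ k * ThreeKP.H τ - ThreeKP.H τ * ThreeKP.B₃' τ k :=
  ⟨ThreeKP.tderiv_zero_H hτ hKP k, ThreeKP.tderiv_one_H hτ hKP k, ThreeKP.tderiv_two_H hτ hKP k,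
    ThreeKP.tderiv_two_H' hτ hKP k⟩
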